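/- Identify $\omega_1$ with the set of countable ordinals, and let $\Diamond$ be the following principle: there is a sequence $\langle f_\alpha\in(2^\alpha)^\omega:\ \omega\le\alpha<\omega_1\rangle$ such that for every $f\in(2^{\omega_1})^\omega$ the set $\{\alpha\in[\omega,\omega_1):\ f(n)\restriction\alpha=f_\alpha(n)\text{ for all }n\in\omega\}$ is stationary in $\omega_1$. Let $\lambda$ be the standard product probability measure on $2^\omega$. For $n\in\omega$ let $\mathcal F_n$ be the family of all sets $\{x\in 2^\omega: x\restriction n\in F\}$ with $F\subseteq 2^n$. For Borel $A\subseteq 2^\omega$ put $\chi_n(A)=\min\{\lambda(A\triangle B): B\in\mathcal F_n\}$, and let $$\mathbb B=\{A\subseteq 2^\omega\text{ Borel}:\ \lim_{n\to\infty} n\cdot\chi_n(A)=0\}.$$ A Boolean algebra $\mathcal A$ is minimally generated if there are an ordinal $\delta$ and a (not necessarily strictly) increasing sequence $\langle\mathcal A_\alpha:\alpha\le\delta\rangle$ of subalgebras of $\mathcal A$ such that $\mathcal A_\delta=\mathcal A$; $\mathcal A_0$ is isomorphic to the free Boolean algebra on countably infinitely many generators; $\mathcal A_\gamma=\bigcup_{\alpha<\gamma}\mathcal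 A_\alpha$ for every limit ordinal $\gamma\le\delta$; and for every $\alpha<\delta$ there is no subalgebra $\mathcal C$ with $\mathcal A_\alpha\subsetneq\mathcal C\subsetneq\mathcal A_{\alpha+1}$. A measure on a Boolean algebra $\mathcal A$ is a finitely additive function $\mu\colon\mathcal A\to\mathbb R$ with $\|\mu\|=\sup\{|\mu(A)|+|\mu(B)|:\ A,B\in\mathcal A,\ A\wedge B=0\}<\infty$. The algebra $\mathcal A$ has the Nikodym property if every sequence $\langle\mu_n\rangle$ of measures on $\mathcal A$ with $\sup_n|\mu_n(A)|<\infty$ for each $A\in\mathcal A$ satisfies $\sup_n\|\mu_n\|<\infty$. An Efimov space is an infinite compact Hausdorff space that contains no non-trivial convergent sequence (a convergent sequence with pairwise distinct terms, all different from the limit) and no homeomorphic copy of $\beta\omega$. Theorem. Assume $\Diamond$. Then there is a minimally generated Boolean algebra $\mathcal B$ of subsets of $2^\omega$, with the set-theoretic operations, such that $\mathrm{Clopen}(2^\omega)\subseteq\mathcal B\subseteq\mathbb B$, and the Stone space of $\mathcal B$ is an Efimov space that is homeomorphic to a perfect subset of $2^{\omega_1}$. Moreover, $\mathcal B$ does not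 have the Nikodym property. -/

import Mathlib

open Filter Topology MeasureTheory Set
open scoped symmDiff

noncomputable section

universe u

/-! ### The Diamond Principle -/

/-- The first uncountable ordinal `ω₁`, as the well-ordered set of all countable ordinals. -/
abbrev OmegaOne : Type 1 := Set.Iio (Ordinal.omega 1 : Ordinal.{0})

/-- The Diamond Principle `◊`: there are sequences `f_α ∈ (2^α)^ω`, `ω ≤ α < ω₁`, such that for
every `g ∈ (2^{ω₁})^ω` the set of all `α ∈ [ω, ω₁)` with `g(n)↾α = f_α(n)` for all `n` is stationary
in `ω₁`. (The values of `f` at finite `α` play no role.) -/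
def DiamondPrinciple : Prop :=
  ∃ f : (α : OmegaOne) → ℕ → (Set.Iio α → Bool),
    ∀ g : ℕ → (OmegaOne → Bool),
      IsStationary {α : OmegaOne | Ordinal.omega0 ≤ (α : Ordinal.{0}) ∧
        ∀ (n : ℕ) (ξ : Set.Iio α), g n ξ = f α n ξ}

/-! ### Minimally generated Boolean algebras -/

/-- `g` freely generates the Boolean algebra `A` (universal property). Homomorphisms of Boolean
algebras are the maps that preserve `⊔, ⊓, ⊤, ⊥` (hence complements). -/
def IsFreelyGeneratedBy {ι : Type*} {A : Type u} [BooleanAlgebra A] (g : ι → A) : Prop :=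
  ∀ (C : Type u) [BooleanAlgebra C] (f : ι → C),
    ∃! φ : BoundedLatticeHom A C, ∀ i, φ (g i) = f i

/-- `A` is (isomorphic to) the free Boolean algebra `Fr(ω)` on countably infinitely many
generators. -/
def IsFreeOnOmega (A : Type*) [BooleanAlgebra A] : Prop :=
  ∃ g : ℕ → A, IsFreelyGeneratedBy g

/-- The subalgebra `B` is a minimal extension of the subalgebra `A`: no subalgebra lies strictly
between them. -/
def IsMinimalExtension {E : Type*} [BooleanAlgebra E] (A B : BooleanSubalgebra E) : Prop :=
  A ≤ B ∧ ¬ ∃ C : BooleanSubalgebra E, A < C ∧ C < B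

/-- `A` is minimally generated: it is the top of a continuous increasing chain
`⟨𝒜 α : α ≤ δ⟩` of subalgebras, starting with `Fr(ω)`, with minimal extensions at successors. -/
def IsMinimallyGenerated (A : Type u) [BooleanAlgebra A] : Prop :=
  ∃ (δ : Ordinal.{u}) (𝒜 : Ordinal.{u} → BooleanSubalgebra A),
    (∀ α β, α ≤ β → β ≤ δ → 𝒜 α ≤ 𝒜 β) ∧
    𝒜 δ = ⊤ ∧
    IsFreeOnOmega (𝒜 0) ∧
    (∀ γ ≤ δ, Order.IsSuccLimit γ → (𝒜 γ : Set A) = ⋃ α < γ, (𝒜 α : Set A)) ∧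
    (∀ α < δ, IsMinimalExtension (𝒜 α) (𝒜 (Order.succ α)))

/-! ### Stone spaces and Efimov spaces -/

/-- The Stone space of a Boolean algebra: its points are the ultrafilters. -/
@[ext]
structure StoneSpace (A : Type*) [BooleanAlgebra A] where
  carrier : Set A
  top_mem : ⊤ ∈ carrier
  bot_notMem : ⊥ ∉ carrier
  mem_of_le : ∀ a b, a ∈ carrier → a ≤ b → b ∈ carrier
  inf_mem : ∀ a b, a ∈ carrier → b ∈ carrier → a ⊓ b ∈ carrier
  mem_or_compl_mem : ∀ a, a ∈ carrier ∨ aᶜ ∈ carrier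

/-- The Stone topology, generated by the sets `{x | a ∈ x}`, `a ∈ A`. -/
instance (A : Type*) [BooleanAlgebra A] : TopologicalSpace (StoneSpace A) :=
  TopologicalSpace.generateFrom (Set.range fun a : A => {x : StoneSpace A | a ∈ x.carrier})

/-- `u` is a non-trivial convergent sequence with limit `x`. -/
def IsNontrivialConvergent {X : Type*} [TopologicalSpace X] (u : ℕ → X) (x : X) : Prop :=
  Tendsto u atTop (𝓝 x) ∧ (∀ m, u m ≠ x) ∧ Function.Injective u

/-- An Efimov space: an infinite compact Hausdorff space with neither a non-trivial convergent
sequence nor a homeomorphic copy of `βω`. -/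
def IsEfimovSpace (X : Type*) [TopologicalSpace X] : Prop :=
  CompactSpace X ∧ T2Space X ∧ Infinite X ∧
    (¬ ∃ (u : ℕ → X) (x : X), IsNontrivialConvergent u x) ∧
    (¬ ∃ e : StoneCech ℕ → X, IsEmbedding e)

/-! ### The Nikodym property -/

/-- The values `|μ(a)| + |μ(b)|` over disjoint `a, b`; their supremum is `‖μ‖`. -/
def variationValues {A : Type*} [BooleanAlgebra A] (μ : A → ℝ) : Set ℝ :=
  {r | ∃ a b : A, a ⊓ b = ⊥ ∧ r = |μ a| + |μ b|}

/-- Bounded finitely additive signed measures on a Boolean algebra. -/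
structure FinAddMeasure (A : Type*) [BooleanAlgebra A] where
  toFun : A → ℝ
  additive : ∀ a b, a ⊓ b = ⊥ → toFun (a ⊔ b) = toFun a + toFun b
  bounded : BddAbove (variationValues toFun)

/-- The norm `‖μ‖`. -/
def FinAddMeasure.totalNorm {A : Type*} [BooleanAlgebra A] (μ : FinAddMeasure A) : ℝ :=
  sSup (variationValues μ.toFun)

/-- The Nikodym property: pointwise bounded sequences of measures are uniformly bounded. -/
def HasNikodymProperty (A : Type*) [BooleanAlgebra A] : Prop :=
  ∀ μ : ℕ → FinAddMeasure A,
    (∀ a, BddAbove (Set.range fun n => |(μ n).toFun a|)) →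
      BddAbove (Set.range fun n => (μ n).totalNorm)

/-! ### The ambient family of Borel subsets of the Cantor space -/

/-- The standard product (coin-tossing) probability measure on `2^ω`. -/
def cantorMeasure : Measure (ℕ → Bool) :=
  Measure.infinitePi fun _ : ℕ => (PMF.uniformOfFintype Bool).toMeasure

/-- The clopen set `[F]` of all `x ∈ 2^ω` with `x↾n ∈ F`, for `F ⊆ 2^n`. -/
def cylinderOf {n : ℕ} (F : Set (Fin n → Bool)) : Set (ℕ → Bool) :=
  {x | (fun i : Fin n => x i) ∈ F}

/-- `χ_n(A) = min {λ(A ∆ [F]) : F ⊆ 2^n}`; the infimum is over a finite non-empty index set. -/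
def chi (n : ℕ) (A : Set (ℕ → Bool)) : ℝ :=
  ⨅ F : Set (Fin n → Bool), cantorMeasure.real (A ∆ cylinderOf F)

/-- The family `𝔹` of all Borel sets `A ⊆ 2^ω` with `n · χ_n(A) → 0`. -/
def ambientAlgebra : Set (Set (ℕ → Bool)) :=
  {A | MeasurableSet[borel (ℕ → Bool)] A ∧
    Tendsto (fun n : ℕ => (n : ℝ) * chi n A) atTop (𝓝 0)}

end

/-! ### The approximation coefficients `χ_n` -/

/-! The algebra is the union of an `ω₁`-chain of countable set algebras `stage a α` inside `𝔹`, each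
obtained from the previous one by adjoining a single set that is simple over it: away from every
member of one ultrafilter `U`, the new set already belongs to the old algebra. Simple extensions are
minimal (`IsSimpleOver.isMinimalExtension`), so minimal generation is built in.

Convergent sequences are destroyed by `exists_splitting_set`. A sequence of distinct ultrafilters on
a countable stage has a cluster point `U` with a decreasing base `b k`, and a subsequence has its
`k`-th term concentrated on `b k \ b (k + 1)`. Members of these terms are shrunk until their
coefficients are summable, and the union over even `k` is adjoined: it stays in `𝔹`, is simple at
`U`, and it and its complement each belong to infinitely many terms. A sequence on the final algebra
is already injective on some countable stage. Diamond guesses its trace at a later stage, and there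
it is split.

Copies of `βω` are excluded by a density argument. Such a copy would realize every subset of a
countable set as the trace of an element, in particular a continuum of independent sets with
pairwise distance eventually at least 1/4. Once countably many of these lie in a stage, every
ultrafilter on a later stage has members of arbitrarily small density. Simplicity then propagates
approximability by that countable stage through the whole chain (`isApproximable_of_isSimpleOver`),
and a countable set cannot approximate a continuum of separated sets.

The Nikodym property fails because of the measures `n (λ(A ∩ G) - λ(A \ G))`, where `G` is the
`n`-th coordinate set: they vanish on sets depending on the first `n` coordinates, so they are
bounded by `2 n χ_n(A)`, while their norms are at least `n`. The Stone space has no isolated points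
because every non-empty element contains a non-empty clopen set (`IsDenseOver`). -/

instance : IsProbabilityMeasure cantorMeasure := by
  unfold cantorMeasure; infer_instance

/-- The generator `{x | x n = 1}` of the algebra of clopen subsets of `2^ω`. -/
def coordSet (n : ℕ) : Set (ℕ → Bool) := {x | x n = true}

/-- The basic clopen set of all `y` that agree with `x` below `m`. -/
def initialCylinder (x : ℕ → Bool) (m : ℕ) : Set (ℕ → Bool) := {y | ∀ i < m, y i = x i}

theorem cylinderOf_compl {n : ℕ} (F : Set (Fin n → Bool)) : cylinderOf Fᶜ = (cylinderOf F)ᶜ := rfl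

theorem cylinderOf_inter {n : ℕ} (F G : Set (Fin n → Bool)) :
    cylinderOf (F ∩ G) = cylinderOf F ∩ cylinderOf G := rfl

theorem cylinderOf_iUnion {n : ℕ} {ι : Type*} (F : ι → Set (Fin n → Bool)) :
    cylinderOf (⋃ i, F i) = ⋃ i, cylinderOf (F i) := by
  ext x; simp [cylinderOf]

theorem measurableSet_cylinderOf {n : ℕ} (F : Set (Fin n → Bool)) :
    MeasurableSet (cylinderOf F) := by
  have : Measurable (fun (x : ℕ → Bool) (i : Fin n) => x i) := by fun_prop
  exact this F.toFinite.measurableSet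

theorem chi_nonneg (n : ℕ) (A : Set (ℕ → Bool)) : 0 ≤ chi n A :=
  Real.iInf_nonneg fun _ => measureReal_nonneg

theorem chi_le (n : ℕ) (A : Set (ℕ → Bool)) (F : Set (Fin n → Bool)) :
    chi n A ≤ cantorMeasure.real (A ∆ cylinderOf F) :=
  ciInf_le (Set.finite_range _).bddBelow F

theorem exists_chi_eq (n : ℕ) (A : Set (ℕ → Bool)) :
    ∃ F : Set (Fin n → Bool), cantorMeasure.real (A ∆ cylinderOf F) = chi n A :=
  exists_eq_ciInf_of_finite

theorem chi_compl (n : ℕ) (A : Set (ℕ → Bool)) : chi n Aᶜ = chi n A := by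
  have key : ∀ A, chi n Aᶜ ≤ chi n A := fun A => by
    obtain ⟨F, hF⟩ := exists_chi_eq n A
    rw [← hF]
    refine (chi_le n Aᶜ Fᶜ).trans_eq ?_
    rw [cylinderOf_compl, compl_symmDiff_compl]
  exact le_antisymm (key A) (by simpa using key Aᶜ)

theorem chi_union_le (n : ℕ) (A B : Set (ℕ → Bool)) : chi n (A ∪ B) ≤ chi n A + chi n B := by
  obtain ⟨F, hF⟩ := exists_chi_eq n A
  obtain ⟨G, hG⟩ := exists_chi_eq n B
  rw [← hF, ← hG]
  refine (chi_le n _ (F ∪ G)).trans ((measureReal_mono ?_).trans (measureReal_union_le _ _))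
  intro x
  simp only [cylinderOf, mem_symmDiff, mem_union, mem_ofPred_eq]
  tauto

theorem chi_iUnion_le (n : ℕ) (a : ℕ → Set (ℕ → Bool)) (hs : Summable fun k => chi n (a k)) :
    chi n (⋃ k, a k) ≤ ∑' k, chi n (a k) := by
  choose F hF using fun k => exists_chi_eq n (a k)
  have hsub : (⋃ k, a k) ∆ cylinderOf (⋃ k, F k) ⊆ ⋃ k, a k ∆ cylinderOf (F k) := by
    rw [cylinderOf_iUnion]
    rintro x (⟨hx, hx'⟩ | ⟨hx, hx'⟩) <;> obtain ⟨k, hk⟩ := mem_iUnion.1 hx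
    · exact mem_iUnion.2 ⟨k, Or.inl ⟨hk, fun h => hx' (mem_iUnion.2 ⟨k, h⟩)⟩⟩
    · exact mem_iUnion.2 ⟨k, Or.inr ⟨hk, fun h => hx' (mem_iUnion.2 ⟨k, h⟩)⟩⟩
  refine (chi_le n _ (⋃ k, F k)).trans ((measureReal_mono hsub).trans ?_)
  refine ENNReal.toReal_le_of_le_ofReal (tsum_nonneg fun k => chi_nonneg _ _) ?_
  rw [ENNReal.ofReal_tsum_of_nonneg (fun k => chi_nonneg _ _) hs]
  refine (measure_iUnion_le _).trans (ENNReal.tsum_le_tsum fun k => ?_)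
  rw [← hF k, ofReal_measureReal]

theorem initialCylinder_eq_cylinderOf (x : ℕ → Bool) {m n : ℕ} (h : m ≤ n) :
    initialCylinder x m = cylinderOf {z : Fin n → Bool | ∀ i : Fin n, (i : ℕ) < m → z i = x i} := by
  ext y
  exact ⟨fun hy i hi => hy i hi, fun hy i hi => hy ⟨i, hi.trans_le h⟩ hi⟩

theorem cantorMeasure_real_initialCylinder (x : ℕ → Bool) (m : ℕ) :
    cantorMeasure.real (initialCylinder x m) = (1 / 2) ^ m := by
  have h : initialCylinder x m = Set.pi (Finset.range m) fun i => {x i} := by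
    ext y; simp [initialCylinder]
  rw [h, cantorMeasure, measureReal_def,
    Measure.infinitePi_pi _ (fun _ _ => measurableSet_singleton _)]
  simp

/-- For `m ≤ n` the cylinder depends on the first `n` coordinates, so an optimal approximant of `c`
may be cut down by it. -/
theorem chi_inter_initialCylinder_le_chi (c : Set (ℕ → Bool)) (x : ℕ → Bool) {m n : ℕ}
    (h : m ≤ n) : chi n (c ∩ initialCylinder x m) ≤ chi n c := by
  obtain ⟨F, hF⟩ := exists_chi_eq n c
  rw [← hF, initialCylinder_eq_cylinderOf x h]
  refine (chi_le n _ (F ∩ {z | ∀ i : Fin n, (i : ℕ) < m → z i = x i})).trans (measureReal_mono ?_)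
  rw [cylinderOf_inter]
  intro y
  simp only [mem_symmDiff, mem_inter_iff]
  tauto

theorem chi_inter_initialCylinder_le_pow (c : Set (ℕ → Bool)) (x : ℕ → Bool) (m n : ℕ) :
    chi n (c ∩ initialCylinder x m) ≤ (1 / 2) ^ m := by
  rw [← cantorMeasure_real_initialCylinder x m]
  refine (chi_le n _ ∅).trans (measureReal_mono ?_)
  intro y
  simp only [mem_symmDiff, mem_inter_iff, cylinderOf, mem_ofPred_eq, mem_empty_iff_false]
  tauto

/-- Sets in `𝔹` have uniformly small pieces on sufficiently fine cylinders. -/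
theorem exists_forall_mul_chi_inter_le {c : Set (ℕ → Bool)} (hc : c ∈ ambientAlgebra) {ε : ℝ}
    (hε : 0 < ε) :
    ∃ m, ∀ x, ∀ n : ℕ, (n : ℝ) * chi n (c ∩ initialCylinder x m) ≤ ε := by
  -- Indices `n ≥ m` are controlled by the coefficients of `c` itself, indices `n ≤ m` by the
  -- measure of the cylinder. Neither bound depends on `x`.
  have h1 : ∀ᶠ m : ℕ in atTop, (m : ℝ) * (1 / 2) ^ m ≤ ε :=
    (tendsto_self_mul_const_pow_of_lt_one (by norm_num) (by norm_num)).eventually_le_const hε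
  have h2 : ∀ᶠ m : ℕ in atTop, ∀ n ≥ m, (n : ℝ) * chi n c ≤ ε :=
    eventually_forall_ge_atTop.2 (hc.2.eventually_le_const hε)
  obtain ⟨m, hm1, hm2⟩ := (h1.and h2).exists
  refine ⟨m, fun x n => ?_⟩
  rcases le_total m n with h | h
  · exact (mul_le_mul_of_nonneg_left (chi_inter_initialCylinder_le_chi c x h)
      n.cast_nonneg).trans (hm2 n h)
  · refine le_trans ?_ hm1
    exact mul_le_mul (by exact_mod_cast h) (chi_inter_initialCylinder_le_pow c x m n)
      (chi_nonneg _ _) m.cast_nonneg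

/-! ### The algebra `𝔹` -/

theorem mem_ambientAlgebra_iff {A : Set (ℕ → Bool)} :
    A ∈ ambientAlgebra ↔
      MeasurableSet A ∧ Tendsto (fun n : ℕ => (n : ℝ) * chi n A) atTop (𝓝 0) := by
  rw [ambientAlgebra, ← BorelSpace.measurable_eq]; rfl

theorem cylinderOf_mem_ambientAlgebra {m : ℕ} (F : Set (Fin m → Bool)) :
    cylinderOf F ∈ ambientAlgebra := by
  refine mem_ambientAlgebra_iff.2 ⟨measurableSet_cylinderOf F, ?_⟩
  refine tendsto_const_nhds.congr' ?_
  filter_upwards [eventually_ge_atTop m] with n hn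
  have h : cylinderOf F = cylinderOf {z : Fin n → Bool | (fun i : Fin m => z (i.castLE hn)) ∈ F} :=
    rfl
  have h0 : chi n (cylinderOf F) ≤ 0 := by
    refine (chi_le n _ {z : Fin n → Bool | (fun i : Fin m => z (i.castLE hn)) ∈ F}).trans ?_
    rw [← h]; simp
  rw [le_antisymm h0 (chi_nonneg _ _), mul_zero]

theorem compl_mem_ambientAlgebra {A : Set (ℕ → Bool)} (hA : A ∈ ambientAlgebra) :
    Aᶜ ∈ ambientAlgebra := by
  rw [mem_ambientAlgebra_iff] at hA ⊢
  simpa only [chi_compl] using And.intro hA.1.compl hA.2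

theorem union_mem_ambientAlgebra {A B : Set (ℕ → Bool)} (hA : A ∈ ambientAlgebra)
    (hB : B ∈ ambientAlgebra) : A ∪ B ∈ ambientAlgebra := by
  rw [mem_ambientAlgebra_iff] at hA hB ⊢
  refine ⟨hA.1.union hB.1, squeeze_zero (fun n => mul_nonneg n.cast_nonneg (chi_nonneg _ _))
    (fun n => ?_) (by simpa using hA.2.add hB.2)⟩
  rw [← mul_add]
  exact mul_le_mul_of_nonneg_left (chi_union_le n A B) n.cast_nonneg

/-- `𝔹` as a Boolean subalgebra of the power set of `2^ω`. -/
def ambientSubalgebra : BooleanSubalgebra (Set (ℕ → Bool)) where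
  carrier := ambientAlgebra
  supClosed' _ ha _ hb := union_mem_ambientAlgebra ha hb
  infClosed' a ha b hb := by
    have := compl_mem_ambientAlgebra
      (union_mem_ambientAlgebra (compl_mem_ambientAlgebra ha) (compl_mem_ambientAlgebra hb))
    rwa [compl_union, compl_compl, compl_compl] at this
  compl_mem' := compl_mem_ambientAlgebra
  bot_mem' := cylinderOf_mem_ambientAlgebra (m := 0) ∅

/-- `𝔹` need not contain all countable unions, but a summable bound uniform in `n` lets dominated
convergence exchange the limit in `n` with the sum over `k`. -/
theorem iUnion_mem_ambientAlgebra {a : ℕ → Set (ℕ → Bool)} (ha : ∀ k, a k ∈ ambientAlgebra)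
    {ε : ℕ → ℝ} (hε : Summable ε) (hle : ∀ k, ∀ n : ℕ, (n : ℝ) * chi n (a k) ≤ ε k) :
    ⋃ k, a k ∈ ambientAlgebra := by
  refine mem_ambientAlgebra_iff.2
    ⟨MeasurableSet.iUnion fun k => (mem_ambientAlgebra_iff.1 (ha k)).1, ?_⟩
  have hnn : ∀ k, ∀ n : ℕ, 0 ≤ (n : ℝ) * chi n (a k) := fun k n =>
    mul_nonneg n.cast_nonneg (chi_nonneg _ _)
  have hs : ∀ n : ℕ, Summable fun k => (n : ℝ) * chi n (a k) := fun n =>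
    Summable.of_nonneg_of_le (fun k => hnn k n) (fun k => hle k n) hε
  have hlim : Tendsto (fun n : ℕ => ∑' k, (n : ℝ) * chi n (a k)) atTop (𝓝 (∑' _ : ℕ, (0 : ℝ))) :=
    tendsto_tsum_of_dominated_convergence hε (fun k => (ha k).2)
      (Eventually.of_forall fun n k => by
        rw [Real.norm_of_nonneg (hnn k n)]; exact hle k n)
  rw [tsum_zero] at hlim
  refine squeeze_zero (fun n => mul_nonneg n.cast_nonneg (chi_nonneg _ _)) (fun n => ?_) hlim
  rcases Nat.eq_zero_or_pos n with rfl | hn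
  · simp
  · have hn' : (n : ℝ) ≠ 0 := by positivity
    rw [tsum_mul_left]
    exact mul_le_mul_of_nonneg_left
      (chi_iUnion_le n a ((summable_mul_left_iff hn').1 (hs n))) n.cast_nonneg

/-! ### Failure of the Nikodym property -/

/-- Flipping the `n`-th coordinate. -/
def flipCoord (n : ℕ) (x : ℕ → Bool) (i : ℕ) : Bool := if i = n then !(x i) else x i

theorem measurePreserving_flipCoord (n : ℕ) :
    MeasurePreserving (flipCoord n) cantorMeasure cantorMeasure := by
  have hnot : ((PMF.uniformOfFintype Bool).toMeasure).map Bool.not =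
      (PMF.uniformOfFintype Bool).toMeasure := by
    refine Measure.ext_of_singleton fun b => ?_
    rw [Measure.map_apply (by fun_prop) (measurableSet_singleton _)]
    have : Bool.not ⁻¹' {b} = {!b} := by ext c; cases b <;> cases c <;> simp
    rw [this]
    simp
  have h := Measure.infinitePi_map_pi (μ := fun _ : ℕ => (PMF.uniformOfFintype Bool).toMeasure)
    (f := fun i b => if i = n then !b else b) (fun i => by fun_prop)
  refine ⟨?_, ?_⟩
  · unfold flipCoord; fun_prop
  · unfold cantorMeasure
    refine Eq.trans h ?_
    congr 1
    funext i
    by_cases hi : i = n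
    · simpa [hi] using hnot
    · simp [hi]

/-- Flipping coordinate `n` preserves the measure, fixes `cylinderOf F` and exchanges the two
halves. -/
theorem cantorMeasure_real_inter_coordSet {n : ℕ} (F : Set (Fin n → Bool)) :
    cantorMeasure.real (cylinderOf F ∩ coordSet n) =
      cantorMeasure.real (cylinderOf F ∩ (coordSet n)ᶜ) := by
  have h := (measurePreserving_flipCoord n).measureReal_preimage
    (s := cylinderOf F ∩ coordSet n)
    ((measurableSet_cylinderOf F).inter (measurableSet_cylinderOf
      {z : Fin (n + 1) → Bool | z ⟨n, n.lt_succ_self⟩ = true})).nullMeasurableSet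
  rw [← h]
  congr 1
  ext x
  have h1 : (fun i : Fin n => flipCoord n x i) = fun i : Fin n => x i := by
    funext i; simp [flipCoord, i.2.ne]
  have h2 : flipCoord n x n = !(x n) := if_pos rfl
  simp only [cylinderOf, coordSet, mem_preimage, mem_inter_iff, mem_ofPred_eq, mem_compl_iff, h1,
    h2, Bool.not_eq_true']
  simp

/-- The signed measure `A ↦ n (λ(A ∩ G) - λ(A \ G))`, where `G` is the `n`-th coordinate set. -/
noncomputable def coordFluctuation (n : ℕ) (A : Set (ℕ → Bool)) : ℝ :=
  n * (cantorMeasure.real (A ∩ coordSet n) - cantorMeasure.real (A ∩ (coordSet n)ᶜ))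

theorem measurableSet_coordSet (n : ℕ) : MeasurableSet (coordSet n) :=
  measurableSet_cylinderOf {z : Fin (n + 1) → Bool | z ⟨n, n.lt_succ_self⟩ = true}

theorem abs_coordFluctuation_le (n : ℕ) (A : Set (ℕ → Bool)) :
    |coordFluctuation n A| ≤ n := by
  rw [coordFluctuation, abs_mul, Nat.abs_cast]
  refine mul_le_of_le_one_right n.cast_nonneg ?_
  rw [abs_le]
  have h1 := measureReal_nonneg (μ := cantorMeasure) (s := A ∩ coordSet n)
  have h2 := measureReal_nonneg (μ := cantorMeasure) (s := A ∩ (coordSet n)ᶜ)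
  have h3 := measureReal_le_one (μ := cantorMeasure) (s := A ∩ coordSet n)
  have h4 := measureReal_le_one (μ := cantorMeasure) (s := A ∩ (coordSet n)ᶜ)
  constructor <;> linarith

theorem coordFluctuation_union (n : ℕ) {A B : Set (ℕ → Bool)} (hB : MeasurableSet B)
    (h : Disjoint A B) :
    coordFluctuation n (A ∪ B) = coordFluctuation n A + coordFluctuation n B := by
  have key : ∀ C, MeasurableSet C → cantorMeasure.real ((A ∪ B) ∩ C) =
      cantorMeasure.real (A ∩ C) + cantorMeasure.real (B ∩ C) := fun C hC => by
    rw [union_inter_distrib_right]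
    exact measureReal_union (h.mono inter_subset_left inter_subset_left) (hB.inter hC)
  rw [coordFluctuation, key _ (measurableSet_coordSet n), key _ (measurableSet_coordSet n).compl]
  unfold coordFluctuation
  ring

/-- The fluctuation of an optimal approximant is zero, and replacing it by `A` changes each of the
two measures by at most `chi n A`. -/
theorem abs_coordFluctuation_le_chi (n : ℕ) {A : Set (ℕ → Bool)} (hA : MeasurableSet A) :
    |coordFluctuation n A| ≤ 2 * (n * chi n A) := by
  obtain ⟨F, hF⟩ := exists_chi_eq n A
  have key : ∀ C, MeasurableSet C →
      |cantorMeasure.real (A ∩ C) - cantorMeasure.real (cylinderOf F ∩ C)| ≤ chi n A :=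
    fun C hC => by
      refine (abs_measureReal_sub_le_measureReal_symmDiff (hA.inter hC).nullMeasurableSet
        ((measurableSet_cylinderOf F).inter hC).nullMeasurableSet).trans ?_
      rw [← hF]
      refine measureReal_mono fun x => ?_
      simp only [mem_symmDiff, mem_inter_iff]
      tauto
  have h1 := key _ (measurableSet_coordSet n)
  have h2 := key _ (measurableSet_coordSet n).compl
  rw [← cantorMeasure_real_inter_coordSet] at h2
  rw [coordFluctuation, abs_mul, Nat.abs_cast, mul_left_comm]
  refine mul_le_mul_of_nonneg_left ?_ n.cast_nonneg
  rw [abs_le] at h1 h2 ⊢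
  constructor <;> linarith [h1.1, h1.2, h2.1, h2.2]

theorem cantorMeasure_real_coordSet (n : ℕ) : cantorMeasure.real (coordSet n) = 1 / 2 := by
  have h1 := cantorMeasure_real_inter_coordSet (n := n) univ
  have h2 := probReal_compl_eq_one_sub (μ := cantorMeasure) (measurableSet_coordSet n)
  have h3 : cylinderOf (univ : Set (Fin n → Bool)) = univ := rfl
  rw [h3, univ_inter, univ_inter] at h1
  linarith

/-- No subalgebra of `𝔹` that contains the coordinate sets has the Nikodym property. -/
theorem not_hasNikodymProperty_of_subset_ambientAlgebra (B : BooleanSubalgebra (Set (ℕ → Bool)))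
    (hB : (B : Set (Set (ℕ → Bool))) ⊆ ambientAlgebra) (hgen : ∀ n, coordSet n ∈ B) :
    ¬ HasNikodymProperty B := by
  intro hN
  have hbdd : ∀ n, 2 * (n : ℝ) ∈
      upperBounds (variationValues fun a : B => coordFluctuation n (a : Set (ℕ → Bool))) := by
    rintro n r ⟨a, b, -, rfl⟩
    linarith [abs_coordFluctuation_le n (a : Set (ℕ → Bool)),
      abs_coordFluctuation_le n (b : Set (ℕ → Bool))]
  let μ : ℕ → FinAddMeasure B := fun n =>
    { toFun := fun a => coordFluctuation n a
      additive := fun a b hab => by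
        refine coordFluctuation_union n (mem_ambientAlgebra_iff.1 (hB b.2)).1 ?_
        rw [disjoint_iff]
        exact congrArg Subtype.val hab
      bounded := ⟨_, hbdd n⟩ }
  have hnorm : ∀ n : ℕ, (n : ℝ) ≤ (μ n).totalNorm := fun n => by
    refine le_csSup (μ n).bounded ⟨⟨coordSet n, hgen n⟩, ⟨(coordSet n)ᶜ, B.compl_mem (hgen n)⟩,
      Subtype.ext (inter_compl_self _), ?_⟩
    have h2 := probReal_compl_eq_one_sub (μ := cantorMeasure) (measurableSet_coordSet n)
    rw [cantorMeasure_real_coordSet] at h2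
    change (n : ℝ) = |coordFluctuation n (coordSet n)| + |coordFluctuation n (coordSet n)ᶜ|
    simp only [coordFluctuation, inter_self, inter_compl_self, compl_inter_self,
      cantorMeasure_real_coordSet, h2, measureReal_empty, abs_mul, Nat.abs_cast]
    rw [sub_zero, zero_sub, abs_neg, abs_of_pos (by norm_num : (0 : ℝ) < 1 / 2),
      abs_of_pos (by norm_num : (0 : ℝ) < 1 - 1 / 2)]
    ring
  obtain ⟨M, hM⟩ := hN μ fun a => by
    have ha := mem_ambientAlgebra_iff.1 (hB a.2)
    obtain ⟨M, hM⟩ := ha.2.bddAbove_range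
    refine ⟨2 * M, ?_⟩
    rintro _ ⟨n, rfl⟩
    exact (abs_coordFluctuation_le_chi n ha.1).trans
      (mul_le_mul_of_nonneg_left (hM ⟨n, rfl⟩) zero_le_two)
  obtain ⟨n, hn⟩ := exists_nat_gt M
  exact absurd ((hnorm n).trans (hM ⟨n, rfl⟩)) (not_le.2 hn)

/-! ### Stone spaces -/

namespace StoneSpace

variable {A : Type*} [BooleanAlgebra A] (p : StoneSpace A) {a b : A}

theorem inf_mem_iff : a ⊓ b ∈ p.carrier ↔ a ∈ p.carrier ∧ b ∈ p.carrier :=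
  ⟨fun h => ⟨p.mem_of_le _ _ h inf_le_left, p.mem_of_le _ _ h inf_le_right⟩,
    fun h => p.inf_mem _ _ h.1 h.2⟩

theorem compl_mem_iff : aᶜ ∈ p.carrier ↔ a ∉ p.carrier :=
  ⟨fun h h' => p.bot_notMem (by simpa using p.inf_mem _ _ h' h),
    fun h => (p.mem_or_compl_mem a).resolve_left h⟩

theorem sup_mem_iff : a ⊔ b ∈ p.carrier ↔ a ∈ p.carrier ∨ b ∈ p.carrier := by
  rw [← not_iff_not, ← compl_mem_iff, compl_sup, inf_mem_iff, compl_mem_iff, compl_mem_iff, not_or]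

theorem sdiff_mem_iff : a \ b ∈ p.carrier ↔ a ∈ p.carrier ∧ b ∉ p.carrier := by
  rw [_root_.sdiff_eq, inf_mem_iff, compl_mem_iff]

/-- The ultrafilters on a subalgebra generated by `s` are determined by their trace on `s`. -/
theorem ext_of_closure {s : Set A} {p q : StoneSpace (BooleanSubalgebra.closure s)}
    (h : ∀ a (ha : a ∈ s), ⟨a, BooleanSubalgebra.subset_closure ha⟩ ∈ p.carrier ↔
      ⟨a, BooleanSubalgebra.subset_closure ha⟩ ∈ q.carrier) : p = q := by
  refine StoneSpace.ext (Set.ext fun ⟨a, ha⟩ => ?_)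
  induction ha using BooleanSubalgebra.closure_bot_sup_induction with
  | mem x hx => exact h x hx
  | bot => exact iff_of_false p.bot_notMem q.bot_notMem
  | sup x hx y hy ihx ihy =>
    exact p.sup_mem_iff.trans ((or_congr ihx ihy).trans q.sup_mem_iff.symm)
  | compl x hx ihx => exact p.compl_mem_iff.trans ((not_congr ihx).trans q.compl_mem_iff.symm)

/-- The preimage of an ultrafilter under a homomorphism. -/
def comap {B : Type*} [BooleanAlgebra B] (φ : BoundedLatticeHom A B) (p : StoneSpace B) :
    StoneSpace A where
  carrier := φ ⁻¹' p.carrier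
  top_mem := by simpa using p.top_mem
  bot_notMem := by simpa using p.bot_notMem
  mem_of_le a b ha hab := p.mem_of_le _ _ ha (OrderHomClass.mono φ hab)
  inf_mem a b ha hb := by
    simpa using p.inf_mem _ _ ha hb
  mem_or_compl_mem a := by
    simpa [map_compl'] using p.mem_or_compl_mem (φ a)

/-- The ultrafilter of all members of a set algebra that contain the point `x`. -/
def ofPoint {X : Type*} (D : BooleanSubalgebra (Set X)) (x : X) : StoneSpace D where
  carrier := {a | x ∈ (a : Set X)}
  top_mem := mem_univ x
  bot_notMem := notMem_empty x
  mem_of_le _ _ ha hab := hab ha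
  inf_mem _ _ ha hb := ⟨ha, hb⟩
  mem_or_compl_mem _ := em _

/-- Ultrafilters separate the elements of a Boolean algebra. -/
theorem exists_mem_notMem (h : ¬ a ≤ b) : ∃ p : StoneSpace A, a ∈ p.carrier ∧ b ∉ p.carrier := by
  obtain ⟨J, hJ, hbJ, hd⟩ := DistribLattice.prime_ideal_of_disjoint_filter_ideal
    (F := Order.PFilter.principal a) (I := Order.Ideal.principal b)
    (Set.disjoint_left.2 fun c hc hc' => h (le_trans hc hc'))
  refine ⟨⟨(J : Set A)ᶜ, ?_, ?_, ?_, ?_, ?_⟩, ?_, ?_⟩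
  · exact fun hT => Set.disjoint_left.1 hd (Order.PFilter.mem_principal.2 le_top) hT
  · exact fun hB => hB J.bot_mem
  · exact fun c d hc hcd hd => hc (J.lower hcd hd)
  · exact fun c d hc hd hcd => (hJ.mem_or_mem hcd).elim hc hd
  · intro c
    by_contra! hc
    simp only [mem_compl_iff, not_not] at hc
    have : (⊤ : A) ∈ J := by simpa using Order.Ideal.sup_mem hc.1 hc.2
    exact Set.disjoint_left.1 hd (Order.PFilter.mem_principal.2 le_top) this
  · exact fun ha => Set.disjoint_left.1 hd (Order.PFilter.mem_principal.2 le_rfl) ha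
  · exact fun hb => hb (hbJ (Order.Ideal.mem_principal.2 le_rfl))

theorem eq_of_forall_mem_iff (h : ∀ p : StoneSpace A, a ∈ p.carrier ↔ b ∈ p.carrier) : a = b := by
  refine le_antisymm ?_ ?_ <;> by_contra hab <;> obtain ⟨p, h1, h2⟩ := exists_mem_notMem hab
  · exact h2 ((h p).1 h1)
  · exact h2 ((h p).2 h1)

theorem isOpen_setOf_mem (a : A) : IsOpen {p : StoneSpace A | a ∈ p.carrier} :=
  TopologicalSpace.isOpen_generateFrom_of_mem ⟨a, rfl⟩

theorem isClopen_setOf_mem (a : A) : IsClopen {p : StoneSpace A | a ∈ p.carrier} := by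
  refine ⟨⟨?_⟩, isOpen_setOf_mem a⟩
  convert isOpen_setOf_mem aᶜ using 1
  ext p
  exact p.compl_mem_iff.symm

theorem isTopologicalBasis : TopologicalSpace.IsTopologicalBasis
    (Set.range fun a : A => {p : StoneSpace A | a ∈ p.carrier}) where
  exists_subset_inter := by
    rintro _ ⟨a, rfl⟩ _ ⟨b, rfl⟩ p hp
    exact ⟨_, ⟨a ⊓ b, rfl⟩, p.inf_mem_iff.2 hp, fun q hq => q.inf_mem_iff.1 hq⟩
  sUnion_eq := eq_univ_of_forall fun p => ⟨_, ⟨⊤, rfl⟩, p.top_mem⟩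
  eq_generateFrom := rfl

theorem exists_mem_notMem_of_ne {p q : StoneSpace A} (hpq : p ≠ q) :
    ∃ a, a ∈ p.carrier ∧ a ∉ q.carrier := by
  by_contra! h
  refine hpq (StoneSpace.ext (Set.ext fun a => ⟨h a, fun ha => ?_⟩))
  by_contra hap
  exact q.compl_mem_iff.1 (h _ (p.compl_mem_iff.2 hap)) ha

instance : T2Space (StoneSpace A) := ⟨fun p q hpq => by
  obtain ⟨a, hp, hq⟩ := exists_mem_notMem_of_ne hpq
  exact ⟨_, _, isOpen_setOf_mem a, isOpen_setOf_mem aᶜ, hp, q.compl_mem_iff.2 hq,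
    Set.disjoint_left.2 fun r h1 h2 => r.compl_mem_iff.1 h2 h1⟩⟩

instance : CompactSpace (StoneSpace A) := by
  refine ⟨isCompact_iff_ultrafilter_le_nhds.2 fun F _ => ?_⟩
  -- The limit of `F` consists of the elements that lie in `F`-almost every point.
  refine ⟨⟨{a | ∀ᶠ q in F, a ∈ StoneSpace.carrier q}, ?_, ?_, ?_, ?_, ?_⟩, mem_univ _, ?_⟩
  · exact Eventually.of_forall fun q => q.top_mem
  · exact fun h => (h.exists).elim fun q hq => q.bot_notMem hq
  · exact fun a b ha hab => ha.mono fun q hq => q.mem_of_le _ _ hq hab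
  · exact fun a b ha hb => (ha.and hb).mono fun q hq => q.inf_mem _ _ hq.1 hq.2
  · intro a
    exact Ultrafilter.eventually_or.1 (Eventually.of_forall fun q => q.mem_or_compl_mem a)
  · rw [TopologicalSpace.nhds_generateFrom]
    refine le_iInf₂ ?_
    rintro _ ⟨ha, a, rfl⟩
    exact le_principal_iff.2 ha

theorem exists_subset_of_isCompact {K U : Set (StoneSpace A)} (hK : IsCompact K) (hU : IsOpen U)
    (hKU : K ⊆ U) :
    ∃ a : A, K ⊆ {p | a ∈ p.carrier} ∧ {p : StoneSpace A | a ∈ p.carrier} ⊆ U := by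
  refine hK.induction_on (p := fun K => ∃ a : A, K ⊆ {p | a ∈ p.carrier} ∧
    {p : StoneSpace A | a ∈ p.carrier} ⊆ U) ⟨⊥, empty_subset _, fun p hp => ?_⟩ ?_ ?_ ?_
  · exact absurd hp p.bot_notMem
  · rintro s t hst ⟨a, h1, h2⟩
    exact ⟨a, hst.trans h1, h2⟩
  · rintro s t ⟨a, h1, h2⟩ ⟨b, h3, h4⟩
    refine ⟨a ⊔ b, union_subset ?_ ?_, fun p hp => (p.sup_mem_iff.1 hp).elim (@h2 p) (@h4 p)⟩
    · exact fun p hp => p.sup_mem_iff.2 (Or.inl (h1 hp))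
    · exact fun p hp => p.sup_mem_iff.2 (Or.inr (h3 hp))
  · intro p hp
    obtain ⟨_, ⟨a, rfl⟩, hpa, ha⟩ := isTopologicalBasis.exists_subset_of_mem_open (hKU hp) hU
    exact ⟨_, mem_nhdsWithin_of_mem_nhds ((isOpen_setOf_mem a).mem_nhds hpa), a, subset_rfl, ha⟩

end StoneSpace

/-! ### Generating subalgebras -/

theorem BooleanSubalgebra.countable_closure {A : Type*} [BooleanAlgebra A] {s : Set A}
    (hs : s.Countable) : (BooleanSubalgebra.closure s : Set A).Countable := by
  let S : ℕ → Set A := fun n => Nat.rec (insert ⊥ s)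
    (fun _ t => (t ∪ image2 (· ⊔ ·) t t) ∪ compl '' t) n
  have hsucc : ∀ n, S (n + 1) = (S n ∪ image2 (· ⊔ ·) (S n) (S n)) ∪ compl '' (S n) := fun _ => rfl
  have hS : ∀ n, (S n).Countable := fun n => by
    induction n with
    | zero => exact hs.insert ⊥
    | succ n ih => exact (ih.union (ih.image2 ih _)).union (ih.image _)
  have hmono : Monotone S := monotone_nat_of_le_succ fun n => by
    rw [hsucc]; exact subset_union_left.trans subset_union_left
  have hsup : ∀ a ∈ ⋃ n, S n, ∀ b ∈ ⋃ n, S n, a ⊔ b ∈ ⋃ n, S n := fun a ha b hb => by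
    obtain ⟨m, hm⟩ := mem_iUnion.1 ha
    obtain ⟨n, hn⟩ := mem_iUnion.1 hb
    refine mem_iUnion.2 ⟨max m n + 1, ?_⟩
    rw [hsucc]
    exact Or.inl (Or.inr ⟨a, hmono (le_max_left m n) hm, b, hmono (le_max_right m n) hn, rfl⟩)
  have hcompl : ∀ a ∈ ⋃ n, S n, aᶜ ∈ ⋃ n, S n := fun a ha => by
    obtain ⟨m, hm⟩ := mem_iUnion.1 ha
    refine mem_iUnion.2 ⟨m + 1, ?_⟩
    rw [hsucc]
    exact Or.inr ⟨a, hm, rfl⟩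
  refine (countable_iUnion hS).mono fun a ha => ?_
  induction ha using BooleanSubalgebra.closure_bot_sup_induction with
  | mem x hx => exact mem_iUnion.2 ⟨0, Or.inr hx⟩
  | bot => exact mem_iUnion.2 ⟨0, Or.inl rfl⟩
  | sup x _ y _ hx hy => exact hsup x hx y hy
  | compl x _ hx => exact hcompl x hx

/-! ### Simple and minimal extensions of set algebras. -/

variable {X : Type*}

/-- Every element of `D[a]` has the form `(d ∩ a) ∪ (e \ a)` with `d, e ∈ D`. -/
theorem BooleanSubalgebra.exists_of_mem_closure_insert {D : BooleanSubalgebra (Set X)}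
    {a c : Set X} (hc : c ∈ closure (insert a (D : Set (Set X)))) :
    ∃ d ∈ D, ∃ e ∈ D, c = (d ∩ a) ∪ (e \ a) := by
  induction hc using closure_bot_sup_induction with
  | mem x hx =>
    rcases hx with rfl | hx
    · exact ⟨univ, D.top_mem, ∅, D.bot_mem, by simp⟩
    · exact ⟨x, hx, x, hx, (inter_union_sdiff x a).symm⟩
  | bot => exact ⟨∅, D.bot_mem, ∅, D.bot_mem, by simp⟩
  | sup x _ y _ hx hy =>
    obtain ⟨d, hd, e, he, rfl⟩ := hx
    obtain ⟨d', hd', e', he', rfl⟩ := hy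
    refine ⟨d ∪ d', D.sup_mem hd hd', e ∪ e', D.sup_mem he he', ?_⟩
    ext z
    simp only [sup_eq_union, mem_union, mem_inter_iff, Set.mem_sdiff]
    tauto
  | compl x _ hx =>
    obtain ⟨d, hd, e, he, rfl⟩ := hx
    refine ⟨dᶜ, D.compl_mem hd, eᶜ, D.compl_mem he, ?_⟩
    ext z
    simp only [mem_union, mem_inter_iff, Set.mem_sdiff, mem_compl_iff]
    tauto

/-- `a` is a simple extension element over `D`: outside of any neighbourhood of a fixed ultrafilter
on `D`, the set `a` belongs to `D`. -/
def IsSimpleOver (D : BooleanSubalgebra (Set X)) (a : Set X) : Prop :=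
  ∃ U : StoneSpace D, ∀ b ∈ U.carrier, a \ (b : Set X) ∈ D

theorem IsSimpleOver.of_mem [Nonempty X] {D : BooleanSubalgebra (Set X)} {a : Set X} (ha : a ∈ D) :
    IsSimpleOver D a :=
  ⟨.ofPoint D (Classical.arbitrary X), fun b _ => D.sdiff_mem ha b.2⟩

theorem IsSimpleOver.inter_mem_or {D : BooleanSubalgebra (Set X)} {a : Set X} {U : StoneSpace D}
    (hU : ∀ b ∈ U.carrier, a \ (b : Set X) ∈ D) {d : Set X} (hd : d ∈ D) :
    (⟨d, hd⟩ : D) ∈ U.carrier ∨ a ∩ d ∈ D := by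
  refine (U.mem_or_compl_mem ⟨d, hd⟩).imp_right fun h => ?_
  have := hU _ h
  rwa [BooleanSubalgebra.compl_mk, sdiff_compl] at this

/-- A new element `c = (d ∩ a) ∪ (e \ a)` agrees with `a` on `d \ e` and with its complement on `e \
d`. If one of these differences belongs to `U`, then `c` recovers `a` there, and the rest of `a` is
in `D`. If neither does, both traces of `a` are in `D`, hence so is `c`. -/
theorem IsSimpleOver.isMinimalExtension {D : BooleanSubalgebra (Set X)} {a : Set X}
    (h : IsSimpleOver D a) :
    IsMinimalExtension D (BooleanSubalgebra.closure (insert a (D : Set (Set X)))) := by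
  obtain ⟨U, hU⟩ := h
  refine ⟨fun x hx => BooleanSubalgebra.subset_closure (Or.inr hx), ?_⟩
  rintro ⟨C, hDC, hCa⟩
  obtain ⟨c, hcC, hcD⟩ := SetLike.exists_of_lt hDC
  suffices haC : a ∈ C from
    hCa.not_ge (BooleanSubalgebra.closure_le.2 (insert_subset haC hDC.le))
  obtain ⟨d, hd, e, he, rfl⟩ := BooleanSubalgebra.exists_of_mem_closure_insert (hCa.le hcC)
  have hde := D.sdiff_mem hd he
  have hed := D.sdiff_mem he hd
  rcases inter_mem_or hU hde with h1 | h1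
  · have : a = (((d ∩ a) ∪ (e \ a)) ∩ (d \ e)) ∪ (a \ (d \ e)) := by
      ext z
      simp only [mem_union, mem_inter_iff, Set.mem_sdiff]
      tauto
    rw [this]
    exact C.sup_mem (C.inf_mem hcC (hDC.le hde)) (hDC.le (hU _ h1))
  rcases inter_mem_or hU hed with h2 | h2
  · have : a = ((e \ d) \ ((d ∩ a) ∪ (e \ a))) ∪ (a \ (e \ d)) := by
      ext z
      simp only [mem_union, mem_inter_iff, Set.mem_sdiff]
      tauto
    rw [this]
    exact C.sup_mem (C.sdiff_mem (hDC.le hed) hcC) (hDC.le (hU _ h2))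
  · refine absurd ?_ hcD
    have : (d ∩ a) ∪ (e \ a) = (d ∩ e) ∪ (a ∩ (d \ e)) ∪ ((e \ d) \ (a ∩ (e \ d))) := by
      ext z
      simp only [mem_union, mem_inter_iff, Set.mem_sdiff]
      tauto
    rw [this]
    exact D.sup_mem (D.sup_mem (D.inf_mem hd he) h1) (D.sdiff_mem hed h2)

theorem IsMinimalExtension.comap_subtype {D E B : BooleanSubalgebra (Set X)}
    (h : IsMinimalExtension D E) (hEB : E ≤ B) :
    IsMinimalExtension (D.comap B.subtype) (E.comap B.subtype) := by
  refine ⟨BooleanSubalgebra.comap_mono h.1, ?_⟩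
  rintro ⟨C, hDC, hCE⟩
  refine h.2 ⟨C.map B.subtype, ?_, ?_⟩
  · refine SetLike.lt_iff_le_and_exists.2 ⟨fun x hx => ⟨⟨x, hEB (h.1 hx)⟩, hDC.le hx, rfl⟩, ?_⟩
    obtain ⟨c, hc, hc'⟩ := SetLike.exists_of_lt hDC
    exact ⟨c, ⟨c, hc, rfl⟩, hc'⟩
  · refine SetLike.lt_iff_le_and_exists.2 ⟨?_, ?_⟩
    · rintro _ ⟨c, hc, rfl⟩
      exact hCE.le hc
    · obtain ⟨c, hc, hc'⟩ := SetLike.exists_of_lt hCE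
      refine ⟨c, hc, ?_⟩
      rintro ⟨c', h1, h2⟩
      exact hc' (Subtype.ext h2 ▸ h1)

/-! ### The free algebra of clopen subsets of the Cantor space -/

theorem initialCylinder_mem {D : BooleanSubalgebra (Set (ℕ → Bool))}
    (hD : ∀ n, coordSet n ∈ D) (x : ℕ → Bool) (m : ℕ) : initialCylinder x m ∈ D := by
  have h : initialCylinder x m = ⨅ i : Fin m, if x i then coordSet i else (coordSet i)ᶜ := by
    ext y
    simp only [initialCylinder, iInf_eq_iInter, mem_iInter, mem_ofPred_eq, Fin.forall_iff]
    refine forall₂_congr fun i _ => ?_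
    cases h : x i <;> simp [coordSet]
  rw [h]
  refine BooleanSubalgebra.iInf_mem fun i => ?_
  split_ifs
  exacts [hD i, D.compl_mem (hD i)]

theorem exists_initialCylinder_subset {U : Set (ℕ → Bool)} (hU : IsOpen U) {x : ℕ → Bool}
    (hx : x ∈ U) : ∃ m, initialCylinder x m ⊆ U := by
  obtain ⟨_, ⟨y, m, rfl⟩, hxy, hy⟩ :=
    (PiNat.isTopologicalBasis_cylinders fun _ : ℕ => Bool).exists_subset_of_mem_open hx hU
  refine ⟨m, fun z hz => hy fun i hi => (hz i hi).trans (hxy i hi)⟩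

theorem isOpen_initialCylinder (x : ℕ → Bool) (m : ℕ) : IsOpen (initialCylinder x m) :=
  PiNat.isOpen_cylinder (fun _ : ℕ => Bool) x m

theorem isClopen_mem {D : BooleanSubalgebra (Set (ℕ → Bool))}
    (hD : ∀ n, coordSet n ∈ D) {U : Set (ℕ → Bool)} (hU : IsClopen U) : U ∈ D := by
  suffices ∃ V ∈ D, U ⊆ V ∧ V ⊆ U by
    obtain ⟨V, hV, h1, h2⟩ := this
    rwa [h1.antisymm h2]
  refine hU.isClosed.isCompact.induction_on (p := fun K => ∃ V ∈ D, K ⊆ V ∧ V ⊆ U)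
    ⟨∅, D.bot_mem, subset_rfl, empty_subset _⟩ ?_ ?_ ?_
  · rintro s t hst ⟨V, hV, h1, h2⟩
    exact ⟨V, hV, hst.trans h1, h2⟩
  · rintro s t ⟨V, hV, h1, h2⟩ ⟨W, hW, h3, h4⟩
    exact ⟨V ∪ W, D.sup_mem hV hW, union_subset_union h1 h3, union_subset h2 h4⟩
  · intro x hx
    obtain ⟨m, hm⟩ := exists_initialCylinder_subset hU.isOpen hx
    exact ⟨_, mem_nhdsWithin_of_mem_nhds ((isOpen_initialCylinder x m).mem_nhds fun _ _ => rfl),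
      _, initialCylinder_mem hD x m, subset_rfl, hm⟩

open Classical in
/-- A Boolean algebra isomorphic to the set algebra generated by the coordinate sets is free. -/
theorem isFreeOnOmega_of_embedding {A : Type u} [BooleanAlgebra A]
    (φ : BoundedLatticeHom A (Set (ℕ → Bool))) (hinj : Function.Injective φ)
    (hrange : range φ = (BooleanSubalgebra.closure (range coordSet) : Set (Set (ℕ → Bool)))) :
    IsFreeOnOmega A := by
  have hmem : ∀ a, φ a ∈ BooleanSubalgebra.closure (range coordSet) := fun a => by
    rw [← SetLike.mem_coe, ← hrange]; exact mem_range_self a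
  have hg : ∀ n, ∃ a, φ a = coordSet n := fun n => by
    have : coordSet n ∈ range φ := by
      rw [hrange]; exact BooleanSubalgebra.subset_closure (mem_range_self n)
    exact this
  choose g hg using hg
  refine ⟨g, fun C _ f => ?_⟩
  -- Stone duality: `f` induces a map from the ultrafilters of `C` to the Cantor space, and the
  -- required homomorphism sends `a` to the element of `C` whose clopen set is the preimage of `φ
  -- a`.
  let pt : StoneSpace C → ℕ → Bool := fun p n => decide (f n ∈ p.carrier)
  have hex : ∀ s ∈ BooleanSubalgebra.closure (range coordSet),
      ∃ c : C, ∀ p : StoneSpace C, c ∈ p.carrier ↔ pt p ∈ s := fun s hs => by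
    induction hs using BooleanSubalgebra.closure_bot_sup_induction with
    | mem x hx =>
      obtain ⟨n, rfl⟩ := hx
      exact ⟨f n, fun p => by simp [pt, coordSet]⟩
    | bot => exact ⟨⊥, fun p => by simp [p.bot_notMem]⟩
    | sup x _ y _ hx hy =>
      obtain ⟨c, hc⟩ := hx
      obtain ⟨d, hd⟩ := hy
      exact ⟨c ⊔ d, fun p => by rw [p.sup_mem_iff, hc, hd]; rfl⟩
    | compl x _ hx =>
      obtain ⟨c, hc⟩ := hx
      exact ⟨cᶜ, fun p => by rw [p.compl_mem_iff, hc]; rfl⟩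
  choose ψ hψ using fun a => hex (φ a) (hmem a)
  refine ⟨⟨⟨⟨ψ, fun a b => ?_⟩, fun a b => ?_⟩, ?_, ?_⟩, fun n => ?_, fun θ hθ => ?_⟩
  · exact StoneSpace.eq_of_forall_mem_iff fun p => by
      rw [p.sup_mem_iff, hψ, hψ, hψ, SupHomClass.map_sup]; rfl
  · exact StoneSpace.eq_of_forall_mem_iff fun p => by
      change ψ (a ⊓ b) ∈ _ ↔ ψ a ⊓ ψ b ∈ _
      rw [p.inf_mem_iff, hψ, hψ, hψ, InfHomClass.map_inf]; rfl
  · exact StoneSpace.eq_of_forall_mem_iff fun p => by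
      change ψ ⊤ ∈ _ ↔ _
      simp [hψ, p.top_mem]
  · exact StoneSpace.eq_of_forall_mem_iff fun p => by
      change ψ ⊥ ∈ _ ↔ _
      simp [hψ, p.bot_notMem]
  · exact StoneSpace.eq_of_forall_mem_iff fun p => by
      change ψ (g n) ∈ _ ↔ _
      simp [hψ, hg, pt, coordSet]
  · refine DFunLike.ext _ _ fun a => ?_
    have hall : ∀ s ∈ BooleanSubalgebra.closure (range coordSet), ∀ a, φ a = s → θ a = ψ a := by
      intro s hs
      induction hs using BooleanSubalgebra.closure_bot_sup_induction with
      | mem x hx =>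
        obtain ⟨n, rfl⟩ := hx
        intro a ha
        rw [hinj (ha.trans (hg n).symm), hθ]
        exact StoneSpace.eq_of_forall_mem_iff fun p => by simp [hψ, hg, pt, coordSet]
      | bot =>
        intro a ha
        rw [hinj (ha.trans (BotHomClass.map_bot φ).symm), BotHomClass.map_bot]
        exact StoneSpace.eq_of_forall_mem_iff fun p => by simp [hψ, p.bot_notMem]
      | sup x hx y hy ihx ihy =>
        intro a ha
        obtain ⟨b, rfl⟩ : x ∈ range φ := hrange ▸ hx
        obtain ⟨c, rfl⟩ : y ∈ range φ := hrange ▸ hy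
        rw [hinj (ha.trans (SupHomClass.map_sup φ b c).symm), SupHomClass.map_sup, ihx b rfl,
          ihy c rfl]
        exact StoneSpace.eq_of_forall_mem_iff fun p => by
          rw [p.sup_mem_iff, hψ, hψ, hψ, SupHomClass.map_sup]; rfl
      | compl x hx ihx =>
        intro a ha
        obtain ⟨b, rfl⟩ : x ∈ range φ := hrange ▸ hx
        rw [hinj (ha.trans (map_compl' φ b).symm), map_compl', ihx b rfl]
        exact StoneSpace.eq_of_forall_mem_iff fun p => by
          rw [p.compl_mem_iff, hψ, hψ, map_compl']; rfl
    exact hall _ (hmem a) a rfl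

/-! ### Splitting a sequence of ultrafilters by a simple extension -/

/-- Every non-empty element of `D[a]` contains a non-empty element of `D`. -/
def IsDenseOver {X : Type*} (D : BooleanSubalgebra (Set X)) (a : Set X) : Prop :=
  ∀ c ∈ BooleanSubalgebra.closure (insert a (D : Set (Set X))), c.Nonempty →
    ∃ e ∈ D, e.Nonempty ∧ e ⊆ c

/-- The set `a` splits the sequence `x` of ultrafilters: in any extension, it belongs to infinitely
many terms, and its complement does as well. -/
def SplitsSequence {X : Type*} {D : BooleanSubalgebra (Set X)} (x : ℕ → StoneSpace D)
    (a : Set X) : Prop :=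
  {n | ∃ d ∈ (x n).carrier, (d : Set X) ⊆ a}.Infinite ∧
    {n | ∃ d ∈ (x n).carrier, Disjoint (d : Set X) a}.Infinite

theorem IsDenseOver.of_mem {X : Type*} {D : BooleanSubalgebra (Set X)} {a : Set X} (ha : a ∈ D) :
    IsDenseOver D a := fun c hc hne =>
  ⟨c, BooleanSubalgebra.closure_le.2 (insert_subset ha subset_rfl) hc, hne, subset_rfl⟩

/-- Members of an ultrafilter on a subalgebra of `𝔹` can be shrunk to have small coefficients. -/
theorem StoneSpace.exists_small_mem {D : BooleanSubalgebra (Set (ℕ → Bool))}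
    (hamb : (D : Set (Set (ℕ → Bool))) ⊆ ambientAlgebra) (hgen : ∀ n, coordSet n ∈ D)
    (p : StoneSpace D) {c : D} (hc : c ∈ p.carrier) {ε : ℝ} (hε : 0 < ε) :
    ∃ a ∈ p.carrier, a ≤ c ∧ ∀ n : ℕ, (n : ℝ) * chi n a ≤ ε := by
  classical
  obtain ⟨m, hm⟩ := exists_forall_mul_chi_inter_le (hamb c.2) hε
  -- The point of the Cantor space below `p`: all its cylinders belong to `p`, so `c` may be
  -- intersected with the one of length `m`.
  let x : ℕ → Bool := fun n => decide (⟨coordSet n, hgen n⟩ ∈ p.carrier)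
  have hx : ∀ m, ⟨initialCylinder x m, initialCylinder_mem hgen x m⟩ ∈ p.carrier := fun m => by
    induction m with
    | zero =>
      convert p.top_mem
      ext y
      simp [initialCylinder]
    | succ m ih =>
      by_cases h : (⟨coordSet m, hgen m⟩ : D) ∈ p.carrier
      · refine p.mem_of_le _ _ (p.inf_mem _ _ ih h) ?_
        rintro y ⟨hy1, hy2⟩ i hi
        rcases Nat.lt_succ_iff_lt_or_eq.1 hi with hi | rfl
        · exact hy1 i hi
        · have hxi : x i = true := decide_eq_true h
          rw [hxi]
          exact hy2
      · refine p.mem_of_le _ _ (p.inf_mem _ _ ih (p.compl_mem_iff.2 h)) ?_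
        rintro y ⟨hy1, hy2⟩ i hi
        rcases Nat.lt_succ_iff_lt_or_eq.1 hi with hi | rfl
        · exact hy1 i hi
        · have hxi : x i = false := decide_eq_false h
          rw [hxi]
          exact Bool.eq_false_iff.2 hy2
  exact ⟨_, p.inf_mem _ _ hc (hx m), inf_le_left, fun n => hm x n⟩

/-- A discrete sequence of ultrafilters together with a decreasing base at a cluster point. -/
theorem StoneSpace.exists_base_of_injective {A : Type*} [BooleanAlgebra A] [Countable A]
    (x : ℕ → StoneSpace A) (hx : Function.Injective x) :
    ∃ (U : StoneSpace A) (b : ℕ → A) (n : ℕ → ℕ), Antitone b ∧ Function.Injective n ∧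
      (∀ a ∈ U.carrier, ∃ k, b k ≤ a) ∧
      ∀ k, b k \ b (k + 1) ∈ (x (n k)).carrier := by
  obtain ⟨U, hU⟩ := exists_clusterPt_of_compactSpace (map x atTop)
  have hinf : ∀ a ∈ U.carrier, {n | a ∈ (x n).carrier}.Infinite := fun a ha =>
    Nat.frequently_atTop_iff_infinite.1
      (mapClusterPt_iff_frequently.1 hU _ ((isOpen_setOf_mem a).mem_nhds ha))
  obtain ⟨c, hc⟩ := (Set.to_countable U.carrier).exists_eq_range ⟨_, U.top_mem⟩
  -- Given `a ∈ U`, pick a term containing `a` and different from `U`. Shrink `a` within `U` to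
  -- avoid that term and to lie below `c k`; the latter makes the resulting sequence a base at `U`.
  have hstep : ∀ (k : ℕ) (a : U.carrier), ∃ (n : ℕ) (a' : U.carrier),
      (a' : A) ≤ a ∧ (a' : A) ≤ c k ∧ (a : A) ∈ (x n).carrier ∧ (a' : A) ∉ (x n).carrier := by
    intro k a
    have hfin : {n | x n = U}.Finite :=
      Set.Subsingleton.finite fun m hm n hn => hx (hm.trans hn.symm)
    obtain ⟨n, hn, hnU⟩ := ((hinf a a.2).sdiff hfin).nonempty
    obtain ⟨u, hu, hun⟩ := exists_mem_notMem_of_ne (Ne.symm hnU)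
    have hck : c k ∈ U.carrier := hc ▸ mem_range_self k
    refine ⟨n, ⟨a ⊓ (c k ⊓ u), U.inf_mem _ _ a.2 (U.inf_mem _ _ hck hu)⟩, inf_le_left,
      inf_le_right.trans inf_le_left, hn, fun h => hun ?_⟩
    exact (x n).mem_of_le _ _ h (inf_le_right.trans inf_le_right)
  choose n next h1 h2 h3 h4 using hstep
  obtain ⟨b, hb⟩ : ∃ b : ℕ → U.carrier, ∀ k, b (k + 1) = next k (b k) :=
    ⟨fun k => Nat.rec ⟨⊤, U.top_mem⟩ next k, fun _ => rfl⟩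
  have hanti : Antitone fun k => (b k).1 :=
    antitone_nat_of_succ_le (f := fun k => (b k).1) fun k =>
      (congrArg Subtype.val (hb k)).trans_le (h1 k (b k))
  have hmem : ∀ k, (b k : A) ∈ (x (n k (b k))).carrier := fun k => h3 k (b k)
  have hnot : ∀ k, (b (k + 1) : A) ∉ (x (n k (b k))).carrier := fun k => by
    rw [hb]; exact h4 k (b k)
  refine ⟨U, fun k => b k, fun k => n k (b k), hanti, ?_, ?_, ?_⟩
  -- The `j`-th chosen term omits `b (j + 1)`, whereas every later chosen term contains it.
  · have hlt : ∀ j k, j < k → n j (b j) ≠ n k (b k) := fun j k hjk h => by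
      refine hnot j ?_
      rw [h]
      exact (x _).mem_of_le _ _ (hmem k) (hanti (Nat.succ_le_of_lt hjk))
    intro j k hjk
    by_contra hne
    rcases lt_or_gt_of_ne hne with h | h
    · exact hlt j k h hjk
    · exact hlt k j h hjk.symm
  · intro a ha
    obtain ⟨k, rfl⟩ : a ∈ range c := hc ▸ ha
    refine ⟨k + 1, ?_⟩
    change (b (k + 1) : A) ≤ _
    rw [hb]
    exact h2 k (b k)
  · exact fun k => (x _).sdiff_mem_iff.2 ⟨hmem k, hnot k⟩

/-- Any sequence of distinct ultrafilters on a countable subalgebra of `𝔹` is split by a simple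
extension inside `𝔹`. -/
theorem exists_splitting_set {D : BooleanSubalgebra (Set (ℕ → Bool))}
    (hcount : (D : Set (Set (ℕ → Bool))).Countable)
    (hamb : (D : Set (Set (ℕ → Bool))) ⊆ ambientAlgebra) (hgen : ∀ n, coordSet n ∈ D)
    (x : ℕ → StoneSpace D) (hx : Function.Injective x) :
    ∃ a ∈ ambientAlgebra, IsSimpleOver D a ∧ IsDenseOver D a ∧ SplitsSequence x a := by
  have : Countable D := hcount.to_subtype
  obtain ⟨U, b, n, hb, hn, hbase, hmem⟩ := StoneSpace.exists_base_of_injective x hx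
  choose a ha hab hsmall using fun k => (x (n k)).exists_small_mem hamb hgen (hmem k)
    (ε := (1 / 2) ^ k) (by positivity)
  have hab1 : ∀ k, (a k : Set (ℕ → Bool)) ⊆ b k := fun k => (hab k).trans sdiff_le
  have hab2 : ∀ k, ∀ z ∈ (a k : Set (ℕ → Bool)), z ∉ (b (k + 1) : Set (ℕ → Bool)) :=
    fun k z hz => (hab k hz).2
  -- Even-indexed terms contain a subset of `S`; odd-indexed ones contain a difference of base
  -- elements disjoint from `S`.
  set S : Set (ℕ → Bool) := ⋃ k, (a (2 * k) : Set (ℕ → Bool)) with hS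
  have hdisj : ∀ k, Disjoint ((b (2 * k + 1) \ b (2 * k + 1 + 1) : D) : Set (ℕ → Bool)) S := by
    intro k
    refine Set.disjoint_left.2 fun z hz hzS => ?_
    obtain ⟨j, hj⟩ := mem_iUnion.1 hzS
    rcases le_or_gt j k with h | h
    · exact hab2 _ z hj (hb (by omega : 2 * j + 1 ≤ 2 * k + 1) hz.1)
    · exact hz.2 (hb (by omega : 2 * k + 1 + 1 ≤ 2 * j) (hab1 _ hj))
  -- Some `b k` lies inside `c` and swallows every piece `a (2 * j)` with `j ≥ k`, so only finitely
  -- many pieces survive outside `c`.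
  have hsimple : ∀ c ∈ U.carrier, S \ (c : Set (ℕ → Bool)) ∈ D := by
    intro c hc
    obtain ⟨k, hk⟩ := hbase c hc
    have : S \ (c : Set (ℕ → Bool)) = (⨆ j : Fin k, (a (2 * j) : Set (ℕ → Bool))) \ c := by
      ext z
      simp only [hS, Set.mem_sdiff, mem_iUnion, iSup_eq_iUnion]
      refine and_congr_left fun hz => ⟨?_, fun ⟨j, hj⟩ => ⟨j, hj⟩⟩
      rintro ⟨j, hj⟩
      refine ⟨⟨j, ?_⟩, hj⟩
      by_contra hjk
      exact hz (hk (hb (by omega : k ≤ 2 * j) (hab1 _ hj)))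
    rw [this]
    exact D.sdiff_mem (BooleanSubalgebra.iSup_mem fun j => (a _).2) c.2
  refine ⟨S, ?_, ⟨U, hsimple⟩, ?_, ?_, ?_⟩
  · refine iUnion_mem_ambientAlgebra (fun k => hamb (a _).2) (ε := fun k => (1 / 2) ^ (2 * k)) ?_
      (fun k m => hsmall _ m)
    simp_rw [pow_mul]
    exact summable_geometric_of_lt_one (by norm_num) (by norm_num)
  · intro c hc hne
    obtain ⟨d, hd, e, he, rfl⟩ := BooleanSubalgebra.exists_of_mem_closure_insert hc
    obtain ⟨z, ⟨hz1, hz2⟩ | hz⟩ := hne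
    · obtain ⟨k, hk⟩ := mem_iUnion.1 hz2
      exact ⟨d ∩ a (2 * k), D.inf_mem hd (a _).2, ⟨z, hz1, hk⟩,
        fun w hw => Or.inl ⟨hw.1, mem_iUnion.2 ⟨k, hw.2⟩⟩⟩
    -- If `e ∈ U`, then `e` contains a late odd difference of base elements, which is non-empty and
    -- misses `S`. Otherwise `e \ S` itself is in `D`.
    · rcases IsSimpleOver.inter_mem_or hsimple he with heU | heS
      · obtain ⟨k, hk⟩ := hbase _ heU
        refine ⟨_, (b (2 * k + 1) \ b (2 * k + 1 + 1) : D).2, ?_, fun w hw => Or.inr ⟨?_, ?_⟩⟩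
        · by_contra hempty
          rw [Set.not_nonempty_iff_eq_empty] at hempty
          have h0 : b (2 * k + 1) \ b (2 * k + 1 + 1) = ⊥ := Subtype.ext hempty
          exact (x _).bot_notMem (h0 ▸ hmem (2 * k + 1))
        · exact hk (hb (by omega : k ≤ 2 * k + 1) hw.1)
        · exact Set.disjoint_left.1 (hdisj k) hw
      · refine ⟨e \ S, ?_, ⟨z, hz⟩, subset_union_right⟩
        have : e \ S = e \ (S ∩ e) := by
          ext w
          simp only [Set.mem_sdiff, mem_inter_iff]
          tauto
        rw [this]
        exact D.sdiff_mem he heS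
  · refine (infinite_range_of_injective (f := fun k => n (2 * k)) fun j k hjk => ?_).mono ?_
    · have := hn hjk
      omega
    · rintro _ ⟨k, rfl⟩
      exact ⟨_, ha (2 * k), subset_iUnion (fun k => (a (2 * k) : Set (ℕ → Bool))) k⟩
  · refine (infinite_range_of_injective (f := fun k => n (2 * k + 1)) fun j k hjk => ?_).mono ?_
    · have := hn hjk
      omega
    · rintro _ ⟨k, rfl⟩
      exact ⟨_, hmem (2 * k + 1), hdisj k⟩

/-! ### The transfinite construction -/

/-- The algebra generated by the coordinate sets and the sets `a ξ`, `ξ < α`. -/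
def stage (a : Ordinal.{0} → Set (ℕ → Bool)) (α : Ordinal.{0}) :
    BooleanSubalgebra (Set (ℕ → Bool)) :=
  BooleanSubalgebra.closure (range coordSet ∪ a '' Iio α)

section stage

variable {a : Ordinal.{0} → Set (ℕ → Bool)} {α β : Ordinal.{0}}

theorem coordSet_mem_stage (n : ℕ) : coordSet n ∈ stage a α :=
  BooleanSubalgebra.subset_closure (Or.inl (mem_range_self n))

theorem mem_stage_of_lt (h : β < α) : a β ∈ stage a α :=
  BooleanSubalgebra.subset_closure (Or.inr (mem_image_of_mem a h))

theorem stage_mono (h : α ≤ β) : stage a α ≤ stage a β :=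
  BooleanSubalgebra.closure_mono (union_subset_union_right _ (image_mono (Iio_subset_Iio h)))

theorem stage_congr {a' : Ordinal.{0} → Set (ℕ → Bool)} (h : ∀ ξ < α, a ξ = a' ξ) :
    stage a α = stage a' α := by
  rw [stage, stage, image_congr (f := a) (g := a') fun ξ hξ => h ξ (mem_Iio.1 hξ)]

theorem stage_zero : stage a 0 = BooleanSubalgebra.closure (range coordSet) := by
  simp [stage]

theorem stage_succ :
    stage a (Order.succ α) =
      BooleanSubalgebra.closure (insert (a α) (stage a α : Set (Set (ℕ → Bool)))) := by
  refine le_antisymm (BooleanSubalgebra.closure_le.2 (union_subset ?_ ?_))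
    (BooleanSubalgebra.closure_le.2 (insert_subset (mem_stage_of_lt (Order.lt_succ α))
      (stage_mono (Order.le_succ α))))
  · rintro _ ⟨n, rfl⟩
    exact BooleanSubalgebra.subset_closure (Or.inr (coordSet_mem_stage n))
  · rintro _ ⟨ξ, hξ, rfl⟩
    rcases (Order.lt_succ_iff.1 (mem_Iio.1 hξ)).eq_or_lt with rfl | h
    · exact BooleanSubalgebra.subset_closure (Or.inl rfl)
    · exact BooleanSubalgebra.subset_closure (Or.inr (mem_stage_of_lt h))

theorem exists_mem_stage_of_isSuccLimit (hα : Order.IsSuccLimit α) {c : Set (ℕ → Bool)}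
    (hc : c ∈ stage a α) : ∃ β < α, c ∈ stage a β := by
  induction hc using BooleanSubalgebra.closure_bot_sup_induction with
  | mem x hx =>
    rcases hx with ⟨n, rfl⟩ | ⟨ξ, hξ, rfl⟩
    · exact ⟨0, hα.bot_lt, coordSet_mem_stage n⟩
    · exact ⟨Order.succ ξ, hα.succ_lt hξ, mem_stage_of_lt (Order.lt_succ ξ)⟩
  | bot => exact ⟨0, hα.bot_lt, BooleanSubalgebra.bot_mem⟩
  | sup x _ y _ hx hy =>
    obtain ⟨β, hβ, h1⟩ := hx
    obtain ⟨γ, hγ, h2⟩ := hy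
    exact ⟨max β γ, max_lt hβ hγ, BooleanSubalgebra.sup_mem (stage_mono (le_max_left _ _) h1)
      (stage_mono (le_max_right _ _) h2)⟩
  | compl x _ hx =>
    obtain ⟨β, hβ, h⟩ := hx
    exact ⟨β, hβ, BooleanSubalgebra.compl_mem h⟩

theorem countable_Iio_of_lt_omega_one (hα : α < Ordinal.omega 1) : (Iio α).Countable := by
  rw [← Cardinal.le_aleph0_iff_set_countable, Cardinal.mk_Iio_ordinal, Cardinal.lift_le_aleph0]
  rw [← Cardinal.ord_aleph, Cardinal.lt_ord, ← Cardinal.succ_aleph0] at hα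
  exact Order.lt_succ_iff.1 hα

theorem countable_stage (hα : α < Ordinal.omega 1) :
    (stage a α : Set (Set (ℕ → Bool))).Countable :=
  BooleanSubalgebra.countable_closure
    ((countable_range _).union ((countable_Iio_of_lt_omega_one hα).image a))

theorem stage_subset_ambientAlgebra (h : ∀ ξ < α, a ξ ∈ ambientAlgebra) :
    (stage a α : Set (Set (ℕ → Bool))) ⊆ ambientAlgebra := by
  refine BooleanSubalgebra.closure_le (L := ambientSubalgebra).2 (union_subset ?_ ?_)
  · rintro _ ⟨n, rfl⟩
    exact cylinderOf_mem_ambientAlgebra {z : Fin (n + 1) → Bool | z ⟨n, n.lt_succ_self⟩ = true}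
  · rintro _ ⟨ξ, hξ, rfl⟩
    exact h ξ hξ

/-- Density passes from the single steps to the whole construction. -/
theorem exists_nonempty_subset_of_mem_stage {δ : Ordinal.{0}}
    (hdense : ∀ ξ < δ, IsDenseOver (stage a ξ) (a ξ)) (hα : α ≤ δ) :
    ∀ c ∈ stage a α, c.Nonempty → ∃ e ∈ stage a 0, e.Nonempty ∧ e ⊆ c := by
  induction α using Ordinal.limitRecOn with
  | zero => exact fun c hc hne => ⟨c, hc, hne, subset_rfl⟩
  | add_one α ih =>
    intro c hc hne
    have hlt : α < δ := (Order.lt_succ α).trans_le hα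
    rw [← Order.succ_eq_add_one, stage_succ] at hc
    obtain ⟨e, he, hne', hec⟩ := hdense α hlt c hc hne
    obtain ⟨e', he', h1, h2⟩ := ih hlt.le e he hne'
    exact ⟨e', he', h1, h2.trans hec⟩
  | limit α hlim ih =>
    intro c hc hne
    obtain ⟨β, hβ, hcβ⟩ := exists_mem_stage_of_isSuccLimit hlim hc
    exact ih β hβ (hβ.le.trans hα) c hcβ hne

end stage

/-- The sequence `x` of ultrafilters on `D` is coded by `g`, relative to the sets `a ξ`, `ξ < α`. -/
def IsCodedBy {D : BooleanSubalgebra (Set (ℕ → Bool))} (x : ℕ → StoneSpace D)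
    (a : Ordinal.{0} → Set (ℕ → Bool)) (α : Ordinal.{0}) (g : ℕ → Ordinal.{0} → Bool) : Prop :=
  ∀ n, ∀ ξ < α, a ξ ∈ Subtype.val '' (x n).carrier ↔ g n ξ = true

/-- The requirements on the set `s` adjoined to `D` at stage `α`. -/
structure IsNextSet (F : Ordinal.{0} → ℕ → Ordinal.{0} → Bool)
    (a : Ordinal.{0} → Set (ℕ → Bool)) (α : Ordinal.{0})
    (D : BooleanSubalgebra (Set (ℕ → Bool))) (s : Set (ℕ → Bool)) : Prop where
  eq_coordSet : ∀ n : ℕ, α = n → s = coordSet n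
  mem_ambientAlgebra : s ∈ ambientAlgebra
  isSimpleOver : IsSimpleOver D s
  isDenseOver : IsDenseOver D s
  splits : Ordinal.omega0 ≤ α → (D : Set (Set (ℕ → Bool))).Countable →
    (D : Set (Set (ℕ → Bool))) ⊆ ambientAlgebra → (∀ n : ℕ, a n = coordSet n) →
    ∀ x : ℕ → StoneSpace D, Function.Injective x → IsCodedBy x a α (F α) → SplitsSequence x s

/-- From stage `ω` on, the sets `a ξ` include the coordinate sets and hence generate the stage, so a
code determines its sequence. One splitting set per stage therefore suffices. -/
theorem IsCodedBy.unique {a : Ordinal.{0} → Set (ℕ → Bool)} {α : Ordinal.{0}}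
    (hα : Ordinal.omega0 ≤ α) (ha : ∀ n : ℕ, a n = coordSet n) {g : ℕ → Ordinal.{0} → Bool}
    {x y : ℕ → StoneSpace (stage a α)} (hx : IsCodedBy x a α g) (hy : IsCodedBy y a α g) :
    x = y := by
  have key : ∀ n, ∀ ξ < α, ∀ h : a ξ ∈ stage a α,
      ⟨a ξ, h⟩ ∈ (x n).carrier ↔ ⟨a ξ, h⟩ ∈ (y n).carrier := by
    intro n ξ hξ h
    have := (hx n ξ hξ).trans (hy n ξ hξ).symm
    simpa [h] using this
  funext n
  refine StoneSpace.ext_of_closure fun s hs => ?_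
  obtain ⟨ξ, hξ, rfl⟩ : ∃ ξ < α, s = a ξ := by
    rcases hs with ⟨n, rfl⟩ | ⟨ξ, hξ, rfl⟩
    · exact ⟨n, (Ordinal.natCast_lt_omega0 n).trans_le hα, (ha n).symm⟩
    · exact ⟨ξ, hξ, rfl⟩
  exact key n ξ hξ _

theorem exists_isNextSet (F : Ordinal.{0} → ℕ → Ordinal.{0} → Bool)
    (a : Ordinal.{0} → Set (ℕ → Bool)) (α : Ordinal.{0}) :
    ∃ s, IsNextSet F a α (stage a α) s := by
  rcases lt_or_ge α Ordinal.omega0 with hα | hα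
  · obtain ⟨n, rfl⟩ := Ordinal.lt_omega0.1 hα
    refine ⟨coordSet n, fun m hm => by rw [Nat.cast_inj.1 hm], ?_,
      .of_mem (coordSet_mem_stage n), .of_mem (coordSet_mem_stage n),
      fun h => absurd hα (not_lt.2 h)⟩
    exact cylinderOf_mem_ambientAlgebra {z : Fin (n + 1) → Bool | z ⟨n, n.lt_succ_self⟩ = true}
  have hnat : ∀ n : ℕ, α ≠ n := fun n h => (Ordinal.natCast_lt_omega0 n).not_ge (h ▸ hα)
  by_cases h : (stage a α : Set (Set (ℕ → Bool))).Countable ∧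
    (stage a α : Set (Set (ℕ → Bool))) ⊆ ambientAlgebra ∧
    ∃ x : ℕ → StoneSpace (stage a α), Function.Injective x ∧ IsCodedBy x a α (F α)
  · obtain ⟨h1, h2, x, hx, hcode⟩ := h
    obtain ⟨s, hs1, hs2, hs3, hs4⟩ := exists_splitting_set h1 h2 coordSet_mem_stage x hx
    refine ⟨s, fun n hn => absurd hn (hnat n), hs1, hs2, hs3, fun _ _ _ ha y _ hy => ?_⟩
    rwa [hy.unique hα ha hcode]
  · refine ⟨∅, fun n hn => absurd hn (hnat n), ambientSubalgebra.bot_mem,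
      .of_mem (stage a α).bot_mem, .of_mem (stage a α).bot_mem, fun _ h1 h2 _ x hx hcode => ?_⟩
    exact absurd ⟨h1, h2, x, hx, hcode⟩ h

theorem exists_construction (F : Ordinal.{0} → ℕ → Ordinal.{0} → Bool) :
    ∃ a : Ordinal.{0} → Set (ℕ → Bool), ∀ α, IsNextSet F a α (stage a α) (a α) := by
  classical
  choose G hG using exists_isNextSet F
  -- The values below `α` are padded by `∅` to a total sequence. The padding is harmless, since the
  -- requirements at `α` read only indices below `α`.
  let a : Ordinal.{0} → Set (ℕ → Bool) := Ordinal.lt_wf.fix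
    fun α prev => G (fun ξ => if h : ξ < α then prev ξ h else ∅) α
  have ha : ∀ α, a α = G (fun ξ => if ξ < α then a ξ else ∅) α := fun α => by
    simp only [a]
    rw [WellFounded.fix_eq]
    simp
  refine ⟨a, fun α => ?_⟩
  have hagree : ∀ ξ < α, (fun ξ => if ξ < α then a ξ else ∅) ξ = a ξ := fun ξ hξ => if_pos hξ
  have h := hG (fun ξ => if ξ < α then a ξ else ∅) α
  rw [← ha, stage_congr hagree] at h
  refine ⟨h.eq_coordSet, h.mem_ambientAlgebra, h.isSimpleOver, h.isDenseOver,
    fun hα h1 h2 h3 x hx hcode => h.splits hα h1 h2 (fun n => ?_) x hx fun n ξ hξ => ?_⟩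
  · rw [← h3]
    exact hagree n ((Ordinal.natCast_lt_omega0 n).trans_le hα)
  · rw [hagree ξ hξ]
    exact hcode n ξ hξ

/-! ### Convergent sequences -/

theorem isSuccLimit_omega_one : Order.IsSuccLimit (Ordinal.omega 1 : Ordinal.{0}) := by
  rw [← Cardinal.ord_aleph]
  exact Cardinal.isSuccLimit_ord (Cardinal.aleph0_le_aleph 1)

/-- A sequence of distinct ultrafilters remains distinct on some countable stage. -/
theorem exists_lt_omega_one_injective_comap {a : Ordinal.{0} → Set (ℕ → Bool)}
    {u : ℕ → StoneSpace (stage a (Ordinal.omega 1))} (hu : Function.Injective u) :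
    ∃ β < Ordinal.omega 1, ∀ α (_ : β ≤ α) (hα : α ≤ Ordinal.omega 1),
      Function.Injective fun n => (u n).comap (BooleanSubalgebra.inclusion (stage_mono hα)) := by
  -- Each pair of terms is separated at a countable stage, and a countable supremum of such stages
  -- is countable.
  have hsep : ∀ q : ℕ × ℕ, ∃ β < Ordinal.omega 1, q.1 ≠ q.2 →
      ∃ b ∈ stage a β, ∀ hb : b ∈ stage a (Ordinal.omega 1),
        ⟨b, hb⟩ ∈ (u q.1).carrier ∧ ⟨b, hb⟩ ∉ (u q.2).carrier := by
    rintro ⟨m, n⟩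
    by_cases hmn : m = n
    · exact ⟨0, isSuccLimit_omega_one.bot_lt, fun h => absurd hmn h⟩
    · obtain ⟨⟨b, hb⟩, h1, h2⟩ := StoneSpace.exists_mem_notMem_of_ne (hu.ne hmn)
      obtain ⟨β, hβ, hbβ⟩ := exists_mem_stage_of_isSuccLimit isSuccLimit_omega_one hb
      exact ⟨β, hβ, fun _ => ⟨b, hbβ, fun _ => ⟨h1, h2⟩⟩⟩
  choose β hβ hsep using hsep
  refine ⟨⨆ q, β q, Ordinal.iSup_lt_omega_one hβ, fun α hβα hα m n hmn => ?_⟩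
  by_contra hne
  obtain ⟨b, hb, h⟩ := hsep (m, n) hne
  have hbα : b ∈ stage a α := stage_mono ((Ordinal.le_iSup β (m, n)).trans hβα) hb
  obtain ⟨h1, h2⟩ := h (stage_mono hα hbα)
  have h3 : (⟨b, hbα⟩ : stage a α) ∈
      ((u m).comap (BooleanSubalgebra.inclusion (stage_mono hα))).carrier := h1
  rw [show (u m).comap (BooleanSubalgebra.inclusion (stage_mono hα)) = _ from hmn] at h3
  exact h2 h3

/-- Whichever of `s` and its complement belongs to `p` defines a neighbourhood of `p` that
infinitely many terms avoid. -/
theorem SplitsSequence.not_tendsto {a : Ordinal.{0} → Set (ℕ → Bool)} {α : Ordinal.{0}}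
    {s : Set (ℕ → Bool)} (hs : s ∈ stage a (Ordinal.omega 1)) (hα : α ≤ Ordinal.omega 1)
    {u : ℕ → StoneSpace (stage a (Ordinal.omega 1))}
    (h : SplitsSequence (fun n => (u n).comap (BooleanSubalgebra.inclusion (stage_mono hα))) s)
    (p : StoneSpace (stage a (Ordinal.omega 1))) : ¬ Tendsto u atTop (𝓝 p) := by
  intro hlim
  by_cases hp : (⟨s, hs⟩ : stage a (Ordinal.omega 1)) ∈ p.carrier
  · have hev := hlim.eventually ((StoneSpace.isOpen_setOf_mem _).mem_nhds hp)
    obtain ⟨n, ⟨d, hd, hds⟩, hn⟩ :=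
      ((Nat.frequently_atTop_iff_infinite.2 h.2).and_eventually hev).exists
    refine (u n).bot_notMem ?_
    convert (u n).inf_mem _ _ hd hn
    exact Subtype.ext hds.inter_eq.symm
  · have hev := hlim.eventually
      ((StoneSpace.isOpen_setOf_mem _).mem_nhds (p.compl_mem_iff.2 hp))
    obtain ⟨n, ⟨d, hd, hds⟩, hn⟩ :=
      ((Nat.frequently_atTop_iff_infinite.2 h.1).and_eventually hev).exists
    exact (u n).compl_mem_iff.1 hn ((u n).mem_of_le _ _ hd hds)

/-- Under the Diamond Principle there is a transfinite construction whose final algebra has no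
non-trivial convergent sequence of ultrafilters. -/
theorem exists_construction_of_diamond (hD : DiamondPrinciple) :
    ∃ a : Ordinal.{0} → Set (ℕ → Bool),
      (∀ n : ℕ, a n = coordSet n) ∧
      (∀ α, a α ∈ ambientAlgebra) ∧
      (∀ α, IsSimpleOver (stage a α) (a α)) ∧
      (∀ α, IsDenseOver (stage a α) (a α)) ∧
      ∀ u : ℕ → StoneSpace (stage a (Ordinal.omega 1)), Function.Injective u →
        ∀ p, ¬ Tendsto u atTop (𝓝 p) := by
  classical
  obtain ⟨f, hf⟩ := hD
  obtain ⟨F, hF⟩ : ∃ F : Ordinal.{0} → ℕ → Ordinal.{0} → Bool,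
      ∀ (α : OmegaOne) (n : ℕ) (ξ : Iio α), F α n ξ.1.1 = f α n ξ := by
    refine ⟨fun α n ξ => if h : ∃ (β : OmegaOne) (η : Iio β), β.1 = α ∧ η.1.1 = ξ then
      f h.choose n h.choose_spec.choose else false, fun α n ξ => ?_⟩
    have h : ∃ (β : OmegaOne) (η : Iio β), β.1 = α.1 ∧ η.1.1 = ξ.1.1 := ⟨α, ξ, rfl, rfl⟩
    have key : ∀ (β : OmegaOne) (η : Iio β), β.1 = α.1 → η.1.1 = ξ.1.1 → f β n η = f α n ξ := by
      intro β η h1 h2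
      obtain rfl : β = α := Subtype.ext h1
      obtain rfl : η = ξ := Subtype.ext (Subtype.ext h2)
      rfl
    exact (dif_pos h).trans
      (key _ _ h.choose_spec.choose_spec.1 h.choose_spec.choose_spec.2)
  obtain ⟨a, ha⟩ := exists_construction F
  have hcoord : ∀ n : ℕ, a n = coordSet n := fun n => (ha n).eq_coordSet n rfl
  refine ⟨a, hcoord, fun α => (ha α).mem_ambientAlgebra, fun α => (ha α).isSimpleOver,
    fun α => (ha α).isDenseOver, fun u hu => ?_⟩
  obtain ⟨β, hβ, hinj⟩ := exists_lt_omega_one_injective_comap hu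
  -- Stationarity is applied to a tail, to obtain a correct guess at a stage where the restricted
  -- sequence is already injective.
  have hclub : IsClub (Ici (⟨β, hβ⟩ : OmegaOne)) :=
    ⟨(isUpperSet_Ici _).dirSupClosed, fun γ =>
      ⟨max γ ⟨β, hβ⟩, mem_Ici.2 (le_max_right _ _), le_max_left _ _⟩⟩
  obtain ⟨⟨α, hα⟩, ⟨hωα, hguess⟩, hβα⟩ := hf
    (fun n ξ => decide (a ξ ∈ Subtype.val '' (u n).carrier)) hclub
  have hα' : α < Ordinal.omega 1 := hα
  have hcode : IsCodedBy (fun n => (u n).comap (BooleanSubalgebra.inclusion (stage_mono hα'.le)))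
      a α (F α) := by
    intro n ξ hξ
    have h1 := (hguess n ⟨⟨ξ, hξ.trans hα'⟩, hξ⟩).trans (hF ⟨α, hα⟩ n ⟨⟨ξ, hξ.trans hα'⟩, hξ⟩).symm
    change _ ↔ F α n ξ = true
    change _ = F α n ξ at h1
    rw [← h1, decide_eq_true_iff]
    constructor
    · rintro ⟨d, hd, hdξ⟩
      exact ⟨_, hd, hdξ⟩
    · rintro ⟨⟨d, hd'⟩, hd, rfl⟩
      exact ⟨⟨_, mem_stage_of_lt hξ⟩, hd, rfl⟩
  exact SplitsSequence.not_tendsto (mem_stage_of_lt hα') hα'.le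
    ((ha α).splits hωα (countable_stage hα')
      (stage_subset_ambientAlgebra fun ξ _ => (ha ξ).mem_ambientAlgebra) hcoord _
      (hinj α hβα hα'.le) hcode)

/-! ### Copies of `βω` -/

/-- A countable set carrying an independent family of size continuum. -/
abbrev FiniteCoding : Type := Σ n : ℕ, ((Fin n → Bool) → Bool)

/-- The density of a set on the `n`-th level. -/
noncomputable def levelDensity (n : ℕ) (S : Set FiniteCoding) : ℝ :=
  ({h : (Fin n → Bool) → Bool | (⟨n, h⟩ : FiniteCoding) ∈ S}.ncard : ℝ) / 2 ^ 2 ^ n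

/-- The independent family, indexed by the points of the Cantor space. -/
def independentSet (x : ℕ → Bool) : Set FiniteCoding := {q | q.2 (fun i => x i) = true}

theorem levelDensity_mono (n : ℕ) {S T : Set FiniteCoding} (h : S ⊆ T) :
    levelDensity n S ≤ levelDensity n T := by
  unfold levelDensity
  gcongr
  · exact Set.toFinite _

theorem levelDensity_union_le (n : ℕ) (S T : Set FiniteCoding) :
    levelDensity n (S ∪ T) ≤ levelDensity n S + levelDensity n T := by
  unfold levelDensity
  rw [← add_div]
  gcongr
  exact_mod_cast Set.ncard_union_le _ _

/-- Each prescribed value at a distinct place halves the number of functions; the product form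
avoids subtraction in the exponent. -/
theorem ncard_setOf_prescribed {ι κ : Type*} [Fintype ι] [Fintype κ] {w : κ → ι}
    (hw : Function.Injective w) (σ : κ → Bool) :
    {h : ι → Bool | ∀ k, h (w k) = σ k}.ncard * 2 ^ Fintype.card κ = 2 ^ Fintype.card ι := by
  classical
  have hset : {h : ι → Bool | ∀ k, h (w k) = σ k} = ↑(Fintype.piFinset fun i =>
      if i ∈ Finset.univ.map ⟨w, hw⟩ then ({Function.extend w σ (fun _ => true) i} : Finset Bool)
      else Finset.univ) := by
    ext h
    simp only [mem_ofPred_eq, Finset.mem_coe, Fintype.mem_piFinset]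
    constructor
    · intro hh i
      split_ifs with hi
      · obtain ⟨k, -, rfl⟩ := Finset.mem_map.1 hi
        simp [hh k, hw.extend_apply]
      · exact Finset.mem_univ _
    · intro hh k
      have := hh (w k)
      have hk : w k ∈ Finset.univ.map ⟨w, hw⟩ := Finset.mem_map.2 ⟨k, Finset.mem_univ _, rfl⟩
      rw [if_pos hk, hw.extend_apply] at this
      exact Finset.mem_singleton.1 this
  have hκ : 2 ^ Fintype.card κ = ∏ i : ι, if i ∈ Finset.univ.map ⟨w, hw⟩ then 2 else 1 := by
    rw [Finset.prod_ite_mem, Finset.univ_inter, Finset.prod_const, Finset.card_map,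
      Finset.card_univ]
  rw [hset, Set.ncard_coe_finset, Fintype.card_piFinset, hκ, ← Finset.prod_mul_distrib]
  have hterm : ∀ i : ι, (if i ∈ Finset.univ.map ⟨w, hw⟩ then
      ({Function.extend w σ (fun _ => true) i} : Finset Bool) else Finset.univ).card *
      (if i ∈ Finset.univ.map ⟨w, hw⟩ then 2 else 1) = 2 := fun i => by
    split_ifs <;> simp
  rw [Finset.prod_congr rfl fun i _ => hterm i, Finset.prod_const, Finset.card_univ]

theorem levelDensity_prescribed {κ : Type*} [Fintype κ] {n : ℕ} {z : κ → ℕ → Bool}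
    (hz : Function.Injective fun k (i : Fin n) => z k i) (σ : κ → Bool) :
    levelDensity n {q | ∀ k, q.2 (fun i => z k i) = σ k} = (1 / 2) ^ Fintype.card κ := by
  have h := ncard_setOf_prescribed hz σ
  have hc : Fintype.card (Fin n → Bool) = 2 ^ n := by simp
  rw [hc] at h
  have h' : ({h : (Fin n → Bool) → Bool | ∀ k, h (fun i => z k i) = σ k}.ncard : ℝ) *
      2 ^ Fintype.card κ = 2 ^ 2 ^ n := by exact_mod_cast h
  unfold levelDensity
  rw [div_eq_iff (by positivity), ← h', one_div, inv_pow]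
  field_simp
  rfl

/-- As soon as `x` and `y` differ below `n`, prescribing `true` at `x` and `false` at `y` has
density exactly 1/4. -/
theorem eventually_quarter_le_levelDensity {x y : ℕ → Bool} (hxy : x ≠ y) :
    ∀ᶠ n in atTop, 1 / 4 ≤ levelDensity n (independentSet x ∆ independentSet y) := by
  obtain ⟨i, hi⟩ := Function.ne_iff.1 hxy
  filter_upwards [eventually_gt_atTop i] with n hn
  have hinj : Function.Injective fun (b : Bool) (j : Fin n) => (if b then x else y) j := by
    intro b c hbc
    have := congrFun hbc ⟨i, hn⟩
    cases b <;> cases c <;> simp_all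
  have h := levelDensity_prescribed (z := fun b => if b then x else y) hinj id
  rw [Fintype.card_bool] at h
  refine le_trans (b := (1 / 2) ^ 2) (by norm_num) (h.ge.trans (levelDensity_mono n
    fun q hq => Or.inl ⟨hq true, fun h => ?_⟩))
  have h2 : q.2 (fun i => y i) = false := hq false
  exact absurd (show q.2 (fun i => y i) = true from h) (by simp [h2])

/-- A copy of `βω` shatters the copy of `ω`. -/
theorem exists_mem_iff_of_isEmbedding {A : Type*} [BooleanAlgebra A]
    {e : StoneCech ℕ → StoneSpace A} (he : IsEmbedding e) (S : Set ℕ) :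
    ∃ b : A, ∀ n, b ∈ (e (stoneCechUnit n)).carrier ↔ n ∈ S := by
  classical
  have hg : Continuous fun n => decide (n ∈ S) := continuous_of_discreteTopology
  set W : Set (StoneCech ℕ) := stoneCechExtend hg ⁻¹' {true} with hW
  have hWc : IsClopen W := (isClopen_discrete _).preimage (continuous_stoneCechExtend hg)
  have hmem : ∀ n, stoneCechUnit n ∈ W ↔ n ∈ S := fun n => by
    simp [hW, stoneCechExtend_stoneCechUnit]
  -- The images of `W` and of its complement are disjoint compact sets, hence separated by an
  -- element of the algebra.
  obtain ⟨b, hb1, hb2⟩ := StoneSpace.exists_subset_of_isCompact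
    (hWc.isClosed.isCompact.image he.continuous)
    (hWc.compl.isClosed.isCompact.image he.continuous).isClosed.isOpen_compl
    (by
      rintro _ ⟨p, hp, rfl⟩ ⟨q, hq, hpq⟩
      exact hq (he.injective hpq ▸ hp))
  refine ⟨b, fun n => ⟨fun h => ?_, fun h => hb1 ⟨_, (hmem n).2 h, rfl⟩⟩⟩
  by_contra hn
  exact hb2 h ⟨_, fun hw => hn ((hmem n).1 hw), rfl⟩

/-- The set of all indices `q` such that the ultrafilter `p q` contains `b`. -/
def traceSet {A : Type*} [BooleanAlgebra A] (p : FiniteCoding → StoneSpace A) (b : A) :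
    Set FiniteCoding := {q | b ∈ (p q).carrier}

/-- `c` can be approximated in density by elements of the set `E`. -/
def IsApproximable {A : Type*} [BooleanAlgebra A] (p : FiniteCoding → StoneSpace A) (E : Set A)
    (c : A) : Prop :=
  ∀ ε > 0, ∃ e ∈ E, ∀ᶠ n in atTop, levelDensity n (traceSet p c ∆ traceSet p e) ≤ ε

/-! ### Approximation of elements in level density. -/

section Approximation

variable {A : Type*} [BooleanAlgebra A] {p : FiniteCoding → StoneSpace A} {E : Set A} {c d : A}

theorem traceSet_compl : traceSet p cᶜ = (traceSet p c)ᶜ := by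
  ext q; exact (p q).compl_mem_iff

theorem traceSet_sup : traceSet p (c ⊔ d) = traceSet p c ∪ traceSet p d := by
  ext q; exact (p q).sup_mem_iff

theorem IsApproximable.of_mem (hc : c ∈ E) : IsApproximable p E c := fun ε hε =>
  ⟨c, hc, Eventually.of_forall fun n => by simpa [levelDensity] using hε.le⟩

theorem IsApproximable.compl (hE : ∀ e ∈ E, eᶜ ∈ E) (hc : IsApproximable p E c) :
    IsApproximable p E cᶜ := fun ε hε => by
  obtain ⟨e, he, h⟩ := hc ε hε
  refine ⟨eᶜ, hE e he, ?_⟩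
  rwa [traceSet_compl, traceSet_compl, compl_symmDiff_compl]

theorem IsApproximable.sup (hE : ∀ e ∈ E, ∀ e' ∈ E, e ⊔ e' ∈ E) (hc : IsApproximable p E c)
    (hd : IsApproximable p E d) : IsApproximable p E (c ⊔ d) := fun ε hε => by
  obtain ⟨e, he, h⟩ := hc (ε / 2) (half_pos hε)
  obtain ⟨e', he', h'⟩ := hd (ε / 2) (half_pos hε)
  refine ⟨e ⊔ e', hE e he e' he', ?_⟩
  filter_upwards [h, h'] with n hn hn'
  refine (levelDensity_mono n ?_).trans ((levelDensity_union_le n _ _).trans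
    ((add_le_add hn hn').trans_eq (add_halves ε)))
  rw [traceSet_sup, traceSet_sup]
  intro q
  simp only [mem_symmDiff, mem_union]
  tauto

end Approximation

/-! ### Approximation along the stages, and the exclusion of `βω`. -/

section Stage

variable {a : Ordinal.{0} → Set (ℕ → Bool)}

/-- The elements of the final algebra that belong to stage `α`. -/
def stageIn (a : Ordinal.{0} → Set (ℕ → Bool)) (α : Ordinal.{0}) :
    Set (stage a (Ordinal.omega 1)) :=
  {c | (c : Set (ℕ → Bool)) ∈ stage a α}

theorem isApproximable_of_mem_stage {p : FiniteCoding → StoneSpace (stage a (Ordinal.omega 1))}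
    {α ξ₀ : Ordinal.{0}} (hα : α ≤ Ordinal.omega 1)
    (h : ∀ ξ (hξ : ξ < α), IsApproximable p (stageIn a ξ₀) ⟨a ξ, mem_stage_of_lt (hξ.trans_le hα)⟩)
    {c : Set (ℕ → Bool)} (hc : c ∈ stage a α) :
    IsApproximable p (stageIn a ξ₀) ⟨c, stage_mono hα hc⟩ := by
  have hsup : ∀ e ∈ stageIn a ξ₀, ∀ e' ∈ stageIn a ξ₀, e ⊔ e' ∈ stageIn a ξ₀ :=
    fun e he e' he' => (stage a ξ₀).sup_mem he he'
  have hcompl : ∀ e ∈ stageIn a ξ₀, eᶜ ∈ stageIn a ξ₀ := fun e he => (stage a ξ₀).compl_mem he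
  induction hc using BooleanSubalgebra.closure_bot_sup_induction with
  | mem x hx =>
    rcases hx with ⟨n, rfl⟩ | ⟨ξ, hξ, rfl⟩
    · exact .of_mem (coordSet_mem_stage (a := a) (α := ξ₀) n)
    · exact h ξ hξ
  | bot => exact .of_mem (stage a ξ₀).bot_mem
  | sup x hx y hy ihx ihy =>
    have := ihx.sup hsup ihy
    exact this
  | compl x hx ih =>
    have := ih.compl hcompl
    exact this

/-- If every ultrafilter on a late stage has elements of small density, then the whole algebra is
approximated by a countable stage. -/
theorem isApproximable_of_isSimpleOver
    {p : FiniteCoding → StoneSpace (stage a (Ordinal.omega 1))} {ξ₀ : Ordinal.{0}}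
    (hsimple : ∀ α, IsSimpleOver (stage a α) (a α))
    (hsmall : ∀ α (_ : ξ₀ ≤ α) (hα : α ≤ Ordinal.omega 1) (U : StoneSpace (stage a α)), ∀ ε > 0,
      ∃ c ∈ U.carrier, ∀ᶠ n in atTop,
        levelDensity n (traceSet p (BooleanSubalgebra.inclusion (stage_mono hα) c)) ≤ ε)
    (c : stage a (Ordinal.omega 1)) : IsApproximable p (stageIn a ξ₀) c := by
  have key : ∀ ξ (hξ : ξ < Ordinal.omega 1),
      IsApproximable p (stageIn a ξ₀) ⟨a ξ, mem_stage_of_lt hξ⟩ := by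
    intro ξ
    induction ξ using WellFoundedLT.induction with
    | ind ξ ih =>
      intro hξ
      rcases lt_or_ge ξ ξ₀ with h | h
      · exact .of_mem (mem_stage_of_lt (a := a) h)
      · intro ε hε
        -- Outside a member `c` of `U` with eventual density at most `ε / 2`, the set `a ξ` belongs
        -- to stage `ξ`, where the induction hypothesis gives an `ε / 2`-approximation.
        obtain ⟨U, hU⟩ := hsimple ξ
        obtain ⟨c, hcU, hc⟩ := hsmall ξ h hξ.le U (ε / 2) (half_pos hε)
        obtain ⟨e, he, h'⟩ := isApproximable_of_mem_stage hξ.le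
          (fun η hη => ih η hη (hη.trans hξ)) (hU c hcU) (ε / 2) (half_pos hε)
        refine ⟨e, he, ?_⟩
        filter_upwards [hc, h'] with n hn hn'
        refine (levelDensity_mono n ?_).trans ((levelDensity_union_le n _ _).trans
          ((add_le_add hn hn').trans_eq (add_halves ε)))
        intro q hq
        by_cases hqc : q ∈ traceSet p (BooleanSubalgebra.inclusion (stage_mono hξ.le) c)
        · exact Or.inl hqc
        · refine Or.inr (hq.imp (fun hq => ⟨?_, hq.2⟩) fun hq => ⟨hq.1, fun h => hq.2 ?_⟩)
          · exact (p q).sdiff_mem_iff.2 ⟨hq.1, hqc⟩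
          · exact ((p q).sdiff_mem_iff (a := ⟨a ξ, mem_stage_of_lt hξ⟩)
              (b := BooleanSubalgebra.inclusion (stage_mono hξ.le) c)).1 h |>.1
  exact isApproximable_of_mem_stage le_rfl key c.2

/-- The ultrafilter decides every `b k`. The meet of its first `m` decisions prescribes the coding
function at `m` places, so its density is eventually at most `2⁻ᵐ`. -/
theorem exists_small_of_independent
    {p : FiniteCoding → StoneSpace (stage a (Ordinal.omega 1))}
    {b : ℕ → Set (ℕ → Bool)} {α : Ordinal.{0}} (hα : α ≤ Ordinal.omega 1)
    (hb : ∀ k, b k ∈ stage a α)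
    (hbp : ∀ k q, ⟨b k, stage_mono hα (hb k)⟩ ∈ (p q).carrier ↔
      q ∈ independentSet fun i => decide (i = k))
    (U : StoneSpace (stage a α)) {ε : ℝ} (hε : 0 < ε) :
    ∃ c ∈ U.carrier, ∀ᶠ n in atTop,
      levelDensity n (traceSet p (BooleanSubalgebra.inclusion (stage_mono hα) c)) ≤ ε := by
  classical
  let σ : ℕ → Bool := fun k => decide (⟨b k, hb k⟩ ∈ U.carrier)
  have hex : ∀ m, ∃ c ∈ U.carrier,
      ∀ q ∈ traceSet p (BooleanSubalgebra.inclusion (stage_mono hα) c), ∀ k < m,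
        q.2 (fun i => decide ((i : ℕ) = k)) = σ k := fun m => by
    induction m with
    | zero => exact ⟨⊤, U.top_mem, fun q _ k hk => absurd hk (Nat.not_lt_zero k)⟩
    | succ m ih =>
      obtain ⟨c, hc, h⟩ := ih
      by_cases hm : (⟨b m, hb m⟩ : stage a α) ∈ U.carrier
      · refine ⟨c ⊓ ⟨b m, hb m⟩, U.inf_mem _ _ hc hm, fun q hq k hk => ?_⟩
        have hq' := (p q).inf_mem_iff (a := BooleanSubalgebra.inclusion (stage_mono hα) c)
          (b := ⟨b m, stage_mono hα (hb m)⟩) |>.1 hq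
        rcases Nat.lt_succ_iff_lt_or_eq.1 hk with hk | rfl
        · exact h q hq'.1 k hk
        · rw [show σ k = true from decide_eq_true hm]
          exact (hbp k q).1 hq'.2
      · refine ⟨c ⊓ ⟨b m, hb m⟩ᶜ, U.inf_mem _ _ hc (U.compl_mem_iff.2 hm), fun q hq k hk => ?_⟩
        have hq' := (p q).inf_mem_iff (a := BooleanSubalgebra.inclusion (stage_mono hα) c)
          (b := ⟨b m, stage_mono hα (hb m)⟩ᶜ) |>.1 hq
        rcases Nat.lt_succ_iff_lt_or_eq.1 hk with hk | rfl
        · exact h q hq'.1 k hk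
        · rw [show σ k = false from decide_eq_false hm, Bool.eq_false_iff]
          exact fun h => (p q).compl_mem_iff.1 hq'.2 ((hbp k q).2 h)
  obtain ⟨m, hm⟩ := exists_pow_lt_of_lt_one hε (by norm_num : (1 / 2 : ℝ) < 1)
  obtain ⟨c, hc, h⟩ := hex m
  refine ⟨c, hc, ?_⟩
  filter_upwards [eventually_ge_atTop m] with n hn
  have hinj : Function.Injective fun (k : Fin m) (i : Fin n) => decide ((i : ℕ) = k) := by
    intro k l hkl
    have := congrFun hkl ⟨k, k.2.trans_le hn⟩
    simpa [Fin.ext_iff] using this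
  have hd := levelDensity_prescribed (z := fun (k : Fin m) i => decide (i = (k : ℕ))) hinj
    fun k => σ k
  rw [Fintype.card_fin] at hd
  exact (levelDensity_mono n fun q hq (k : Fin m) => h q hq k k.2).trans (hd.trans_le hm.le)

/-- The Stone space of an `ω₁`-chain of simple extensions contains no copy of `βω`. -/
theorem not_exists_isEmbedding_stoneCech (hsimple : ∀ α, IsSimpleOver (stage a α) (a α)) :
    ¬ ∃ e : StoneCech ℕ → StoneSpace (stage a (Ordinal.omega 1)), IsEmbedding e := by
  rintro ⟨e, he⟩
  obtain ⟨j, hj⟩ := exists_injective_nat FiniteCoding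
  let p : FiniteCoding → StoneSpace (stage a (Ordinal.omega 1)) := fun q =>
    e (stoneCechUnit (j q))
  have hshatter : ∀ S : Set FiniteCoding, ∃ b : stage a (Ordinal.omega 1),
      ∀ q, b ∈ (p q).carrier ↔ q ∈ S := fun S => by
    obtain ⟨b, hb⟩ := exists_mem_iff_of_isEmbedding he (j '' S)
    exact ⟨b, fun q => (hb (j q)).trans hj.mem_set_image⟩
  choose b hb using fun x => hshatter (independentSet x)
  -- The unit vectors index a countable subfamily of the independent sets, which therefore appears
  -- by a countable stage.
  choose β hβ hbβ using fun k : ℕ =>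
    exists_mem_stage_of_isSuccLimit isSuccLimit_omega_one (b fun i => decide (i = k)).2
  have hξ₀ : ⨆ k, β k < Ordinal.omega 1 := Ordinal.iSup_lt_omega_one hβ
  have happrox := isApproximable_of_isSimpleOver (p := p) (ξ₀ := ⨆ k, β k) hsimple
    fun α hξα hα U ε hε => exists_small_of_independent hα
      (b := fun k => (b fun i => decide (i = k) : Set (ℕ → Bool)))
      (fun k => stage_mono ((Ordinal.le_iSup β k).trans hξα) (hbβ k)) (fun k q => hb _ q) U hε
  -- Two points with the same approximant would be within `2 / 9 < 1 / 4` of each other; any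
  -- constant below 1/8 would do.
  choose c hc hclose using fun x => happrox (b x) (1 / 9) (by norm_num)
  have hnot : ¬ Function.Injective fun x => (⟨c x, hc x⟩ : stage a (⨆ k, β k)) := fun hinj => by
    have : Countable (stage a (⨆ k, β k)) := (countable_stage hξ₀).to_subtype
    have hlt : Cardinal.aleph0 < Cardinal.mk (ℕ → Bool) := by
      simpa using Cardinal.cantor Cardinal.aleph0
    exact hlt.not_ge (Cardinal.mk_le_aleph0_iff.2 hinj.countable)
  obtain ⟨x, y, hxy, hne⟩ := Function.not_injective_iff.1 hnot
  have hcxy : c x = c y := Subtype.ext (Subtype.mk.inj hxy)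
  have htr : ∀ x, traceSet p (b x) = independentSet x := fun x => Set.ext (hb x)
  obtain ⟨n, h1, h2, h3⟩ :=
    ((hclose x).and ((hclose y).and (eventually_quarter_le_levelDensity hne))).exists
  rw [htr] at h1 h2
  rw [← hcxy] at h2
  have h4 : levelDensity n (independentSet x ∆ independentSet y) ≤ 1 / 9 + 1 / 9 := by
    refine (levelDensity_mono n ?_).trans ((levelDensity_union_le n _ _).trans (add_le_add h1 h2))
    intro q
    simp only [mem_symmDiff, mem_union]
    tauto
  linarith

end Stage

/-! ### The final algebra -/

theorem StoneSpace.ofPoint_injective {D : BooleanSubalgebra (Set (ℕ → Bool))}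
    (hD : ∀ n, coordSet n ∈ D) : Function.Injective (StoneSpace.ofPoint D) := by
  intro x y hxy
  funext n
  have h : (⟨coordSet n, hD n⟩ : D) ∈ (StoneSpace.ofPoint D x).carrier ↔
      (⟨coordSet n, hD n⟩ : D) ∈ (StoneSpace.ofPoint D y).carrier := by rw [hxy]
  exact Bool.eq_iff_iff.2 h

theorem isOpen_of_mem_closure_range_coordSet {e : Set (ℕ → Bool)}
    (he : e ∈ BooleanSubalgebra.closure (range coordSet)) : IsOpen e := by
  suffices IsClopen e from this.isOpen
  induction he using BooleanSubalgebra.closure_bot_sup_induction with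
  | mem x hx =>
    obtain ⟨n, rfl⟩ := hx
    exact (isClopen_discrete {true}).preimage (continuous_apply n)
  | bot => exact isClopen_empty
  | sup x _ y _ hx hy => exact hx.union hy
  | compl x _ hx => exact hx.compl

theorem nontrivial_of_isOpen {e : Set (ℕ → Bool)} (he : IsOpen e) (hne : e.Nonempty) :
    e.Nontrivial := by
  obtain ⟨x, hx⟩ := hne
  obtain ⟨m, hm⟩ := exists_initialCylinder_subset he hx
  refine ⟨x, hx, Function.update x m (!(x m)), hm fun i hi => ?_, fun h => ?_⟩
  · rw [Function.update_of_ne hi.ne]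
  · have := congrFun h m
    simp at this

section FinalAlgebra

variable {a : Ordinal.{0} → Set (ℕ → Bool)}

theorem isMinimallyGenerated_stage (hsimple : ∀ α, IsSimpleOver (stage a α) (a α)) :
    IsMinimallyGenerated (stage a (Ordinal.omega 1)) := by
  refine ⟨Ordinal.omega 1, fun α => (stage a α).comap (stage a (Ordinal.omega 1)).subtype,
    fun α β h _ => BooleanSubalgebra.comap_mono (stage_mono h), ?_, ?_, fun γ hγ hlim => ?_,
    fun α hα => ?_⟩
  · exact eq_top_iff.2 fun c _ => c.2
  · refine isFreeOnOmega_of_embedding ((stage a (Ordinal.omega 1)).subtype.comp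
      (BooleanSubalgebra.subtype _)) (Subtype.val_injective.comp Subtype.val_injective) ?_
    rw [← stage_zero (a := a)]
    ext c
    constructor
    · rintro ⟨d, rfl⟩
      exact d.2
    · intro hc
      exact ⟨⟨⟨c, stage_mono zero_le hc⟩, hc⟩, rfl⟩
  · ext c
    simp only [mem_iUnion, exists_prop]
    constructor
    · exact fun hc => exists_mem_stage_of_isSuccLimit hlim hc
    · rintro ⟨α, hα, hc⟩
      exact stage_mono (a := a) hα.le hc
  · refine IsMinimalExtension.comap_subtype ?_ (stage_mono (Order.succ_le_of_lt hα))
    rw [stage_succ]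
    exact (hsimple α).isMinimalExtension

open Classical in
/-- The code of an ultrafilter on the final algebra as a point of `2^{ω₁}`. -/
noncomputable def ultrafilterCode (a : Ordinal.{0} → Set (ℕ → Bool))
    (p : StoneSpace (stage a (Ordinal.omega 1))) (ξ : OmegaOne) : Bool :=
  decide (⟨a ξ, mem_stage_of_lt ξ.2⟩ ∈ p.carrier)

theorem continuous_ultrafilterCode : Continuous (ultrafilterCode a) := by
  refine continuous_pi fun ξ => (continuous_bool_rng true).2 ?_
  convert StoneSpace.isClopen_setOf_mem
    (⟨a ξ, mem_stage_of_lt ξ.2⟩ : stage a (Ordinal.omega 1)) using 1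
  ext p
  simp [ultrafilterCode]

theorem ultrafilterCode_injective (ha : ∀ n : ℕ, a n = coordSet n) :
    Function.Injective (ultrafilterCode a) := by
  intro p q hpq
  refine StoneSpace.ext_of_closure fun s hs => ?_
  obtain ⟨ξ, hξ, rfl⟩ : ∃ ξ < Ordinal.omega 1, s = a ξ := by
    rcases hs with ⟨n, rfl⟩ | ⟨ξ, hξ, rfl⟩
    · exact ⟨n, (Ordinal.natCast_lt_omega0 n).trans Ordinal.omega0_lt_omega_one, (ha n).symm⟩
    · exact ⟨ξ, hξ, rfl⟩
  exact decide_eq_decide.1 (congrFun hpq ⟨ξ, hξ⟩)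

theorem isClosedEmbedding_ultrafilterCode (ha : ∀ n : ℕ, a n = coordSet n) :
    IsClosedEmbedding (ultrafilterCode a) :=
  continuous_ultrafilterCode.isClosedEmbedding (ultrafilterCode_injective ha)

/-- A member of `p` contains a non-empty clopen set, hence two points of the Cantor space. Their
point ultrafilters are distinct, so at least one differs from `p`. -/
theorem exists_ne_mem_of_isDenseOver (hdense : ∀ α, IsDenseOver (stage a α) (a α))
    (p : StoneSpace (stage a (Ordinal.omega 1))) {b : stage a (Ordinal.omega 1)}
    (hb : b ∈ p.carrier) : ∃ q : StoneSpace (stage a (Ordinal.omega 1)), q ≠ p ∧ b ∈ q.carrier := by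
  have hne : (b : Set (ℕ → Bool)).Nonempty := by
    by_contra h
    rw [Set.not_nonempty_iff_eq_empty] at h
    have h0 : b = ⊥ := Subtype.ext h
    exact p.bot_notMem (h0 ▸ hb)
  obtain ⟨e, he, hene, heb⟩ := exists_nonempty_subset_of_mem_stage
    (fun ξ _ => hdense ξ) le_rfl _ b.2 hne
  rw [stage_zero] at he
  obtain ⟨x, hx, y, hy, hxy⟩ :=
    nontrivial_of_isOpen (isOpen_of_mem_closure_range_coordSet he) hene
  have hxy' := (StoneSpace.ofPoint_injective
    (D := stage a (Ordinal.omega 1)) coordSet_mem_stage).ne hxy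
  by_cases h : StoneSpace.ofPoint (stage a (Ordinal.omega 1)) x = p
  · exact ⟨.ofPoint _ y, fun h' => hxy' (h.trans h'.symm), heb hy⟩
  · exact ⟨.ofPoint _ x, h, heb hx⟩

theorem perfect_range_ultrafilterCode (ha : ∀ n : ℕ, a n = coordSet n)
    (hdense : ∀ α, IsDenseOver (stage a α) (a α)) : Perfect (range (ultrafilterCode a)) := by
  refine ⟨(isClosedEmbedding_ultrafilterCode ha).isClosed_range, ?_⟩
  rintro _ ⟨p, rfl⟩
  refine accPt_iff_nhds.2 fun U hU => ?_
  obtain ⟨_, ⟨b, rfl⟩, hpb, hbU⟩ := StoneSpace.isTopologicalBasis.mem_nhds_iff.1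
    (continuous_ultrafilterCode.continuousAt hU)
  obtain ⟨q, hqp, hqb⟩ := exists_ne_mem_of_isDenseOver hdense p hpb
  exact ⟨_, ⟨hbU hqb, mem_range_self q⟩, (ultrafilterCode_injective ha).ne hqp⟩

end FinalAlgebra

theorem theorem5p5 (hDiamond : DiamondPrinciple) :
    ∃ B : BooleanSubalgebra (Set (ℕ → Bool)),
      {A : Set (ℕ → Bool) | IsClopen A} ⊆ (B : Set (Set (ℕ → Bool))) ∧
      (B : Set (Set (ℕ → Bool))) ⊆ ambientAlgebra ∧
      IsMinimallyGenerated B ∧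
      IsEfimovSpace (StoneSpace B) ∧
      (∃ K : Set (OmegaOne → Bool), Perfect K ∧ Nonempty (StoneSpace B ≃ₜ K)) ∧
      ¬ HasNikodymProperty B := by
  obtain ⟨a, hcoord, hamb, hsimple, hdense, hconv⟩ := exists_construction_of_diamond hDiamond
  have hsub := stage_subset_ambientAlgebra (α := Ordinal.omega 1) fun ξ _ => hamb ξ
  refine ⟨stage a (Ordinal.omega 1), fun A hA => isClopen_mem coordSet_mem_stage hA, hsub,
    isMinimallyGenerated_stage hsimple,
    ⟨inferInstance, inferInstance,
      Infinite.of_injective _ (StoneSpace.ofPoint_injective coordSet_mem_stage), ?_,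
      not_exists_isEmbedding_stoneCech hsimple⟩,
    ⟨_, perfect_range_ultrafilterCode hcoord hdense,
      ⟨(isClosedEmbedding_ultrafilterCode hcoord).isEmbedding.toHomeomorph⟩⟩,
    not_hasNikodymProperty_of_subset_ambientAlgebra _ hsub coordSet_mem_stage⟩
  rintro ⟨u, p, hlim, -, hinj⟩
  exact hconv u hinj p hlim
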